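/- All graphs are finite and simple. Call a graph $G$ with at least two vertices $k$-connected if any two distinct vertices $u,v$ of $G$ are joined by $k$ different paths that are pairwise internally disjoint (no two of them share a vertex other than $u$ and $v$). A longest cycle (longest path) of $G$ is a cycle (path) with the maximum number of edges among all cycles (paths) of $G$. Let $n$ and $k$ be natural numbers and let $G$ be a $k$-connected graph on $n$ vertices. (1) If $k \ge \frac{n+16}{7}$, then any two longest cycles of $G$ have at least $k$ common vertices. (2) If $k \ge \frac{n+9}{7}$, then any two longest paths of $G$ have at least $k$ common vertices. -/

import Mathlib

universe u

namespace SimpleGraph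

variable {V : Type u} (G : SimpleGraph V)

/-- `G` is `k`-connected: `G` has at least two vertices, and any two distinct vertices `a`, `b` are
joined by a set of `k` (different) pairwise internally disjoint paths, that is, paths of which any
two share no vertex other than `a` and `b`. -/
def IsKConnected (k : ℕ) : Prop :=
  Nontrivial V ∧ ∀ a b : V, a ≠ b →
    ∃ S : Finset (G.Path a b), S.card = k ∧
      ∀ P ∈ S, ∀ Q ∈ S, P ≠ Q →
        ∀ x : V, x ∈ P.1.support → x ∈ Q.1.support → x = a ∨ x = b

variable {G}

namespace Walk

/-- A path of `G` whose length (number of edges) is maximum among all paths of `G`. -/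
def IsLongestPath {a b : V} (P : G.Walk a b) : Prop :=
  P.IsPath ∧ ∀ (c d : V) (Q : G.Walk c d), Q.IsPath → Q.length ≤ P.length

/-- A cycle of `G` whose length (number of edges) is maximum among all cycles of `G`. -/
def IsLongestCycle {a : V} (C : G.Walk a a) : Prop :=
  C.IsCycle ∧ ∀ (b : V) (D : G.Walk b b), D.IsCycle → D.length ≤ C.length

end Walk

end SimpleGraph

/-- The assertion `C(k, r)` for graphs on `n` vertices: in every `k`-connected graph on `n` vertices,
any two longest cycles have at least `r` common vertices. -/
def LongestCyclesConjecture (n k r : ℕ) : Prop :=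
  ∀ (V : Type u) [Fintype V] (G : SimpleGraph V), Fintype.card V = n → G.IsKConnected k →
    ∀ (a b : V) (C : G.Walk a a) (D : G.Walk b b), C.IsLongestCycle → D.IsLongestCycle →
      r ≤ {x : V | x ∈ C.support ∧ x ∈ D.support}.ncard

/-- The assertion `P(k, r)` for graphs on `n` vertices: in every `k`-connected graph on `n` vertices,
any two longest paths have at least `r` common vertices. -/
def LongestPathsConjecture (n k r : ℕ) : Prop :=
  ∀ (V : Type u) [Fintype V] (G : SimpleGraph V), Fintype.card V = n → G.IsKConnected k →
    ∀ (a b c d : V) (P : G.Walk a b) (Q : G.Walk c d), P.IsLongestPath → Q.IsLongestPath →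
      r ≤ {x : V | x ∈ P.support ∧ x ∈ Q.support}.ncard

/-!
Let `C` and `D` be longest cycles, of length `L`, of a `K`-connected graph on `n` vertices, `K ≥ 3`.
They have at least `2 L - n` common vertices, so that a good lower bound for `L` suffices. How good
it has to be depends on the longest paths in the graph without `C`, which may be assumed nonempty.

* If no such path has an edge, then no two consecutive vertices of `D` lie outside `C`. So at
  least `L / 2` vertices of `D` lie on `C`, and `L ≥ 2 K` as a component outside `C` has at least
  `K` neighbours on `C`, no two of them consecutive.
* If such a path has one edge `xy`, then at least `L / 3` vertices of `D` lie on `C`, and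
  `{x, y}` is a component outside `C`. Here `L ≥ 3 K - 2` (`IsLongestOutside.three_mul_le`).
* If such a path has two edges or more, then `L ≥ 4 K - 7` (`IsLongestOutside.four_mul_le`), and
  `2 L - n ≥ K` as soon as `n + 14 ≤ 7 K`.

The length bounds come from gaps. Let `H` be the component outside `C` of a longest path from `x`
to `y` outside `C`, of length `l`. Two neighbours of `H` on `C` are at distance at least `2`
along `C`, and at distance at least `m + 2` if they are joined through `H` by a path of length
`m` outside `C`. A neighbour of `x` and one of `y` are therefore at distance at least `l + 2`,
and this is a good bound if `x` and `y` have many neighbours on `C`. All other neighbours of `x`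
and `y` lie on the path. If there are many, they close a cycle `Z` in `H` whose length `q` is
larger than their number. By Menger's theorem there are `min q K` disjoint paths from `Z` to `C`.
Joining two of them by the longer arc of `Z` shows that `min q K` of the gaps between consecutive
neighbours of `H` have length at least `q / 2 + 2`
(`WellConnected.two_mul_card_attachments_add_le`). That these gaps can be taken between
consecutive neighbours is due to the transitivity of not being linked to `Z` by disjoint paths
(`LinkedTo.or_of_mem_attachments`). The two bounds together give `L ≥ 4 K - 7`, except that in
the case of a triangle `H` the vertices `x` and `y` have to be chosen suitably.

The statement on paths follows by adding a vertex that is adjacent to all others: this turns longest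
paths into longest cycles, and raises the connectivity, the number of vertices and the number of
common vertices by one.
-/

/-! ### Gaps between the elements of a set of residues -/

namespace ZMod

variable {L : ℕ}

/-- The distance from `t` to the next element of `T` in the cyclic order of `ZMod L`: the least
`d > 0` with `t + d ∈ T`. For `t ∈ T` and `0 < L` such a `d` exists, as `d = L` will do. -/
noncomputable def gap (T : Finset (ZMod L)) (t : ZMod L) : ℕ :=
  sInf {d : ℕ | 0 < d ∧ t + (d : ZMod L) ∈ T}

/-- The element of `T` that follows `t` in the cyclic order of `ZMod L`. -/
noncomputable def next (T : Finset (ZMod L)) (t : ZMod L) : ZMod L := t + (gap T t : ZMod L)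

theorem gap_le {T : Finset (ZMod L)} {t : ZMod L} {d : ℕ} (hd : 0 < d)
    (h : t + (d : ZMod L) ∈ T) : gap T t ≤ d :=
  Nat.sInf_le ⟨hd, h⟩

theorem add_natCast_injOn (t : ZMod L) {i j : ℕ} (hi : i < L) (hj : j < L)
    (h : t + (i : ZMod L) = t + (j : ZMod L)) : i = j := by
  have h' := (ZMod.natCast_eq_natCast_iff' i j L).1 (add_left_cancel h)
  rwa [Nat.mod_eq_of_lt hi, Nat.mod_eq_of_lt hj] at h'

variable [NeZero L]

theorem gap_spec {T : Finset (ZMod L)} {t : ZMod L} (ht : t ∈ T) :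
    0 < gap T t ∧ next T t ∈ T :=
  Nat.sInf_mem (s := {d : ℕ | 0 < d ∧ t + (d : ZMod L) ∈ T})
    ⟨L, Nat.pos_of_ne_zero (NeZero.ne L), by simpa using ht⟩

/-- The arcs from the elements of `T` up to the next ones are disjoint. -/
theorem sum_gap_le (T : Finset (ZMod L)) : ∑ t ∈ T, gap T t ≤ L := by
  have key : ∀ t ∈ T, ∀ t' ∈ T, ∀ i < gap T t, ∀ j ≤ i,
      t + (i : ZMod L) = t' + (j : ZMod L) → i = j := by
    intro t ht t' ht' i hi j hj h
    by_contra hne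
    have h1 : t + ((i - j : ℕ) : ZMod L) = t' := by
      rw [Nat.cast_sub hj, ← add_sub_assoc, h, add_sub_cancel_right]
    have := gap_le (T := T) (t := t) (d := i - j) (by omega) (h1 ▸ ht')
    omega
  calc ∑ t ∈ T, gap T t = (T.sigma fun t => Finset.range (gap T t)).card := by simp
    _ ≤ (Finset.univ : Finset (ZMod L)).card := by
        refine Finset.card_le_card_of_injOn (fun p => p.1 + (p.2 : ZMod L)) (by simp) ?_
        rintro ⟨t, i⟩ hp ⟨t', j⟩ hq h
        simp only [Finset.coe_sigma, Set.mem_sigma_iff, Finset.mem_coe, Finset.mem_range] at hp hq h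
        have hij : i = j := by
          rcases le_total j i with hji | hij
          · exact key t hp.1 t' hq.1 i hp.2 j hji h
          · exact (key t' hq.1 t hp.1 j hq.2 i hij h.symm).symm
        subst hij
        have := add_right_cancel h
        subst this
        rfl
    _ = L := by simp [ZMod.card]

theorem exists_natCast_add_eq (t t' : ZMod L) : ∃ d < L, t + (d : ZMod L) = t' :=
  ⟨(t' - t).val, ZMod.val_lt _, by simp⟩

theorem gap_lt {T : Finset (ZMod L)} (hT : 1 < T.card) (t : ZMod L) : gap T t < L := by
  obtain ⟨t', ht', hne⟩ := Finset.exists_mem_ne hT t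
  obtain ⟨d, hd, rfl⟩ := exists_natCast_add_eq t t'
  refine (gap_le (Nat.pos_of_ne_zero ?_) ht').trans_lt hd
  rintro rfl
  simp at hne

/-- Walking from element to element one leaves every nonempty proper subset of `T`. -/
theorem exists_next_notMem {T U : Finset (ZMod L)} (hU : U ⊆ T) (hne : U.Nonempty)
    (hUT : U ≠ T) : ∃ t ∈ U, next T t ∈ T ∧ next T t ∉ U := by
  by_contra! hcl
  obtain ⟨u, hu⟩ := hne
  have key : ∀ d : ℕ, ∀ t ∈ U, t + (d : ZMod L) ∈ T → t + (d : ZMod L) ∈ U := by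
    intro d
    induction d using Nat.strong_induction_on with
    | _ d ih =>
      intro t ht hd
      rcases Nat.eq_zero_or_pos d with rfl | hpos
      · simpa using ht
      have hg := gap_le hpos hd
      have hs := gap_spec (hU ht)
      have e : t + (d : ZMod L) = next T t + ((d - gap T t : ℕ) : ZMod L) := by
        rw [Nat.cast_sub hg, next]; ring
      rw [e]
      exact ih _ (by omega) _ (hcl t ht hs.2) (e ▸ hd)
  refine hUT (hU.antisymm fun t' ht' => ?_)
  obtain ⟨d, -, rfl⟩ := exists_natCast_add_eq u t'
  exact key d u hu ht'

/-- If all gaps are at least `2`, and those that start in `W` at least `e + 2`. -/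
theorem two_mul_card_add_le {T W : Finset (ZMod L)} {e : ℕ} (hW : W ⊆ T)
    (h2 : ∀ t ∈ T, 2 ≤ gap T t) (he : ∀ t ∈ W, e + 2 ≤ gap T t) :
    2 * T.card + e * W.card ≤ L := by
  refine le_trans ?_ (sum_gap_le T)
  have h1 : ∑ t ∈ T, (2 + if t ∈ W then e else 0) = 2 * T.card + e * W.card := by
    rw [Finset.sum_add_distrib, Finset.sum_ite_mem, Finset.inter_eq_right.2 hW]
    simp [mul_comm]
  rw [← h1]
  refine Finset.sum_le_sum fun t ht => ?_
  split_ifs with h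
  · have := he t h; omega
  · exact h2 t ht

/-- A set of residues that meets every interval of `r` consecutive ones has at least `L / r`
elements. -/
theorem le_mul_card_of_consecutive {r : ℕ} (M : Finset (ZMod L))
    (h : ∀ j : ZMod L, ∃ i < r, j + (i : ZMod L) ∈ M) : L ≤ r * M.card := by
  calc L = (Finset.univ : Finset (ZMod L)).card := by simp [ZMod.card]
    _ ≤ ((Finset.range r ×ˢ M).image fun p => p.2 - (p.1 : ZMod L)).card := by
        refine Finset.card_le_card fun j _ => ?_
        obtain ⟨i, hi, hM⟩ := h j
        exact Finset.mem_image.2 ⟨(i, j + i), by simp [hi, hM], by simp⟩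
    _ ≤ _ := Finset.card_image_le
    _ = r * M.card := by simp

end ZMod

/-! ### Menger's theorem -/

namespace SimpleGraph

variable {V : Type u}

/-- A walk in a graph `G` that has at most the edge `xy` in addition to those of `G'` can be
replaced by a walk in `G'`, or else by walks in `G'` before and after one passage through that
edge. -/
theorem Walk.exists_walk_of_le_add_edge {G G' : SimpleGraph V} {x y : V}
    (hadj : ∀ u v, G.Adj u v → G'.Adj u v ∨ (u = x ∧ v = y) ∨ (u = y ∧ v = x)) {a b : V}
    (w : G.Walk a b) :
    (∃ p : G'.Walk a b, p.support ⊆ w.support) ∨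
    (∃ (p : G'.Walk a x) (q : G'.Walk y b), p.support ⊆ w.support ∧ q.support ⊆ w.support) ∨
    (∃ (p : G'.Walk a y) (q : G'.Walk x b), p.support ⊆ w.support ∧ q.support ⊆ w.support) := by
  induction w with
  | nil => exact Or.inl ⟨.nil, by simp⟩
  | @cons a c b h w ih =>
    have hsub : w.support ⊆ (Walk.cons h w).support := by simp
    rcases hadj _ _ h with h' | ⟨rfl, rfl⟩ | ⟨rfl, rfl⟩
    · have cons_sub : ∀ {d : V} (p : G'.Walk c d), p.support ⊆ w.support →
          (Walk.cons h' p).support ⊆ (Walk.cons h w).support := fun p hp => by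
        simpa using List.cons_subset_cons a hp
      rcases ih with ⟨p, hp⟩ | ⟨p, q, hp, hq⟩ | ⟨p, q, hp, hq⟩
      · exact Or.inl ⟨_, cons_sub p hp⟩
      · exact Or.inr (Or.inl ⟨_, q, cons_sub p hp, List.Subset.trans hq hsub⟩)
      · exact Or.inr (Or.inr ⟨_, q, cons_sub p hp, List.Subset.trans hq hsub⟩)
    · rcases ih with ⟨p, hp⟩ | ⟨p, q, hp, hq⟩ | ⟨p, q, hp, hq⟩
      · exact Or.inr (Or.inl ⟨.nil, p, by simp, List.Subset.trans hp hsub⟩)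
      · exact Or.inr (Or.inl ⟨.nil, q, by simp, List.Subset.trans hq hsub⟩)
      · exact Or.inl ⟨q, List.Subset.trans hq hsub⟩
    · rcases ih with ⟨p, hp⟩ | ⟨p, q, hp, hq⟩ | ⟨p, q, hp, hq⟩
      · exact Or.inr (Or.inr ⟨.nil, p, by simp, List.Subset.trans hp hsub⟩)
      · exact Or.inl ⟨q, List.Subset.trans hq hsub⟩
      · exact Or.inr (Or.inr ⟨.nil, q, by simp, List.Subset.trans hq hsub⟩)

/-- There are `k` pairwise disjoint paths from `A` to `B`. -/
def HasDisjointPaths (G : SimpleGraph V) (A B : Finset V) (k : ℕ) : Prop :=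
  ∃ (a b : Fin k → V) (w : ∀ i, G.Walk (a i) (b i)), (∀ i, (w i).IsPath) ∧ (∀ i, a i ∈ A) ∧
    (∀ i, b i ∈ B) ∧ ∀ i j v, v ∈ (w i).support → v ∈ (w j).support → i = j

/-- Fewer than `k` vertices do not separate `A` from `B`. -/
def NotSeparatedBelow (G : SimpleGraph V) (A B : Finset V) (k : ℕ) : Prop :=
  ∀ X : Finset V, X.card < k →
    ∃ a ∈ A, ∃ b ∈ B, ∃ w : G.Walk a b, ∀ v ∈ w.support, v ∉ X

theorem NotSeparatedBelow.symm {G : SimpleGraph V} {A B : Finset V} {k : ℕ}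
    (h : G.NotSeparatedBelow A B k) : G.NotSeparatedBelow B A k := fun X hX => by
  obtain ⟨a, ha, b, hb, w, hw⟩ := h X hX
  exact ⟨b, hb, a, ha, w.reverse, by simpa using hw⟩

theorem HasDisjointPaths.symm {G : SimpleGraph V} {A B : Finset V} {k : ℕ}
    (h : G.HasDisjointPaths A B k) : G.HasDisjointPaths B A k := by
  obtain ⟨a, b, w, hp, ha, hb, hd⟩ := h
  exact ⟨b, a, fun i => (w i).reverse, fun i => (hp i).reverse, hb, ha, by simpa using hd⟩

/-- If `S` separates `A` from `B`, and also from `y`, in the graph without the edge `xy`, then a set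
that separates `A` from `S ∪ {x}` in that graph separates `A` from `B` in the whole graph. -/
theorem NotSeparatedBelow.insert_of_edge [DecidableEq V] {G G' : SimpleGraph V} {x y : V}
    (hadj : ∀ u v, G.Adj u v → G'.Adj u v ∨ (u = x ∧ v = y) ∨ (u = y ∧ v = x))
    {A B S : Finset V} {k : ℕ} (h : G.NotSeparatedBelow A B k)
    (hB : ∀ a ∈ A, ∀ b ∈ B, ∀ w : G'.Walk a b, ∃ v ∈ w.support, v ∈ S)
    (hy : ∀ a ∈ A, ∀ w : G'.Walk a y, ∃ v ∈ w.support, v ∈ S) :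
    G'.NotSeparatedBelow A (insert x S) k := by
  intro X hX
  obtain ⟨a, ha, b, hb, w, hw⟩ := h X hX
  have hit : ∀ {c : V} (p : G'.Walk a c), p.support ⊆ w.support → (∃ v ∈ p.support, v ∈ S) →
      ∃ a ∈ A, ∃ b ∈ insert x S, ∃ w : G'.Walk a b, ∀ v ∈ w.support, v ∉ X := by
    rintro c p hp ⟨v, hv, hvS⟩
    exact ⟨a, ha, v, Finset.mem_insert_of_mem hvS, p.takeUntil v hv, fun u hu =>
      hw u (hp (p.support_takeUntil_subset_support hv hu))⟩
  rcases w.exists_walk_of_le_add_edge hadj with ⟨p, hp⟩ | ⟨p, q, hp, hq⟩ | ⟨p, q, hp, hq⟩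
  · exact hit p hp (hB a ha b hb p)
  · exact ⟨a, ha, x, by simp, p, fun u hu => hw u (hp hu)⟩
  · exact hit p hp (hy a ha p)

theorem Walk.IsPath.eq_of_end_mem_takeUntil [DecidableEq V] {G : SimpleGraph V} {a b v : V}
    {w : G.Walk a b} (hw : w.IsPath) (hv : v ∈ w.support) (h : b ∈ (w.takeUntil v hv).support) :
    v = b := by
  by_contra hne
  exact Walk.endpoint_notMem_support_takeUntil hw hv (fun e => hne e.symm) h

/-- `k` disjoint paths that end in a set of at most `k` vertices meet it in their ends only. -/
theorem eq_end_of_mem_support {G : SimpleGraph V} {P : Finset V} {k : ℕ} (hP : P.card ≤ k)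
    {a b : Fin k → V} {w : ∀ i, G.Walk (a i) (b i)} (hb : ∀ i, b i ∈ P)
    (hd : ∀ i j v, v ∈ (w i).support → v ∈ (w j).support → i = j) :
    (∀ v ∈ P, ∃ i, b i = v) ∧ ∀ i, ∀ v ∈ (w i).support, v ∈ P → v = b i := by
  have hinj : Function.Injective b := fun i j h =>
    hd i j (b i) (w i).end_mem_support (by rw [h]; exact (w j).end_mem_support)
  have hsurj : ∀ v ∈ P, ∃ i, b i = v := by
    have := Finset.surj_on_of_inj_on_of_card_le (s := Finset.univ) (t := P) (fun i _ => b i)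
      (fun i _ => hb i) (fun i j _ _ h => hinj h) (by simpa using hP)
    intro v hv
    obtain ⟨i, -, h⟩ := this v hv
    exact ⟨i, h.symm⟩
  refine ⟨hsurj, fun i v hv hvP => ?_⟩
  obtain ⟨j, rfl⟩ := hsurj v hvP
  rw [hd i j _ hv (w j).end_mem_support]

/-- Paths from `A` to `S ∪ {x}` and from `S ∪ {y}` to `B` are linked by the edge `xy` to paths from
`A` to `B`, if `S` separates `A` from `B` in the graph without that edge. -/
theorem HasDisjointPaths.of_edge [DecidableEq V] {G G' : SimpleGraph V} {x y : V} (hle : G' ≤ G)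
    (hxy : G.Adj x y) {A B S : Finset V} {k : ℕ} (hS : S.card < k) (hyS : y ∉ S)
    (hB : ∀ a ∈ A, ∀ b ∈ B, ∀ w : G'.Walk a b, ∃ v ∈ w.support, v ∈ S)
    (h1 : G'.HasDisjointPaths A (insert x S) k) (h2 : G'.HasDisjointPaths (insert y S) B k) :
    G.HasDisjointPaths A B k := by
  obtain ⟨a1, b1, w1, hp1, ha1, hb1, hd1⟩ := h1
  obtain ⟨a2, b2, w2, hp2, ha2, hb2, hd2⟩ := h2
  obtain ⟨-, he1⟩ := eq_end_of_mem_support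
    ((Finset.card_insert_le x S).trans hS) hb1 hd1
  obtain ⟨hs2, he2⟩ := eq_end_of_mem_support (w := fun i => (w2 i).reverse)
    ((Finset.card_insert_le y S).trans hS) ha2 (by simpa using hd2)
  have cross : ∀ i m v, v ∈ (w1 i).support → v ∈ (w2 m).support → v ∈ S ∧ v = b1 i ∧ v = a2 m := by
    intro i m v hv1 hv2
    have hv2' : v ∈ (w2 m).reverse.support := by simpa using hv2
    have key : v ∈ S := by
      obtain ⟨s, hs, hsS⟩ := hB _ (ha1 i) _ (hb2 m)
        (((w1 i).takeUntil v hv1).append ((w2 m).reverse.takeUntil v hv2').reverse)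
      rw [Walk.mem_support_append_iff, Walk.support_reverse, List.mem_reverse] at hs
      rcases hs with hs | hs
      · have e := he1 i s (Walk.support_takeUntil_subset_support _ _ hs)
          (Finset.mem_insert_of_mem hsS)
        subst e
        rwa [(hp1 i).eq_of_end_mem_takeUntil hv1 hs]
      · have e := he2 m s (Walk.support_takeUntil_subset_support _ _ hs)
          (Finset.mem_insert_of_mem hsS)
        subst e
        rwa [(hp2 m).reverse.eq_of_end_mem_takeUntil hv2' hs]
    exact ⟨key, he1 i v hv1 (Finset.mem_insert_of_mem key),
      he2 m v hv2' (Finset.mem_insert_of_mem key)⟩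
  have hσ : ∀ i, ∃ j, (b1 i ∈ S ∧ a2 j = b1 i) ∨ (b1 i = x ∧ a2 j = y) := by
    intro i
    rcases Finset.mem_insert.1 (hb1 i) with h | h
    · obtain ⟨j, hj⟩ := hs2 y (by simp)
      exact ⟨j, Or.inr ⟨h, hj⟩⟩
    · obtain ⟨j, hj⟩ := hs2 _ (Finset.mem_insert_of_mem h)
      exact ⟨j, Or.inl ⟨h, hj⟩⟩
  choose σ hσ using hσ
  have hσinj : ∀ i j, σ i = σ j → i = j := by
    intro i j hij
    have hb : b1 i = b1 j := by
      have h1 := hσ i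
      have h2 := hσ j
      rw [hij] at h1
      rcases h1 with ⟨h, e⟩ | ⟨h, e⟩ <;> rcases h2 with ⟨h', e'⟩ | ⟨h', e'⟩
      · rw [← e, ← e']
      · exact absurd (by rwa [← e', e]) hyS
      · exact absurd (by rwa [← e, e']) hyS
      · rw [h, h']
    exact hd1 i j _ (w1 i).end_mem_support (by rw [hb]; exact (w1 j).end_mem_support)
  have hw : ∀ i, ∃ w : G.Walk (a1 i) (b2 (σ i)), ∀ v ∈ w.support,
      v ∈ (w1 i).support ∨ v ∈ (w2 (σ i)).support := by
    intro i
    have e : a2 (σ i) = b1 i ∨ G.Adj (b1 i) (a2 (σ i)) := by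
      rcases hσ i with ⟨-, h⟩ | ⟨h, h'⟩
      · exact Or.inl h
      · rw [h, h']; exact Or.inr hxy
    rcases e with e | e
    · refine ⟨((w1 i).mapLe hle).append (((w2 (σ i)).mapLe hle).copy e rfl), fun v hv => ?_⟩
      simpa using hv
    · refine ⟨((w1 i).mapLe hle).append (.cons e ((w2 (σ i)).mapLe hle)), fun v hv => ?_⟩
      rw [Walk.mem_support_append_iff] at hv
      rcases hv with hv | hv
      · exact Or.inl (by simpa using hv)
      · rw [Walk.support_cons, List.mem_cons] at hv
        rcases hv with rfl | hv
        · exact Or.inl (w1 i).end_mem_support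
        · exact Or.inr (by simpa using hv)
  choose w hw using hw
  have hcross : ∀ i j v, v ∈ (w1 i).support → v ∈ (w2 (σ j)).support → i = j := by
    intro i j v h h'
    obtain ⟨hvS, e1, e2⟩ := cross i _ v h h'
    rcases hσ j with ⟨-, e⟩ | ⟨-, e⟩
    · exact hd1 i j v h (by rw [e2, e]; exact (w1 j).end_mem_support)
    · exact absurd (e ▸ e2 ▸ hvS) hyS
  refine ⟨a1, fun i => b2 (σ i), fun i => (w i).bypass, fun i => (w i).bypass_isPath, ha1,
    fun i => hb2 _, fun i j v hi hj => ?_⟩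
  rcases hw i v ((w i).support_bypass_subset_support hi) with h | h <;>
    rcases hw j v ((w j).support_bypass_subset_support hj) with h' | h'
  · exact hd1 i j v h h'
  · exact hcross i j v h h'
  · exact (hcross j i v h' h).symm
  · exact hσinj i j (hd2 _ _ v h h')

theorem HasDisjointPaths.of_edge_of_walks [DecidableEq V] {G G' : SimpleGraph V} {x y : V}
    (hle : G' ≤ G) (hxy : G.Adj x y)
    (hadj : ∀ u v, G.Adj u v → G'.Adj u v ∨ (u = x ∧ v = y) ∨ (u = y ∧ v = x))
    {A B S : Finset V} {k : ℕ} (h : G.NotSeparatedBelow A B k) (hS : S.card < k)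
    (hB : ∀ a ∈ A, ∀ b ∈ B, ∀ w : G'.Walk a b, ∃ v ∈ w.support, v ∈ S)
    {a b : V} (ha : a ∈ A) (hb : b ∈ B) (p : G'.Walk a x) (q : G'.Walk y b)
    (hp : ∀ v ∈ p.support, v ∉ S) (hq : ∀ v ∈ q.support, v ∉ S)
    (ih : ∀ (A B : Finset V), G'.NotSeparatedBelow A B k → G'.HasDisjointPaths A B k) :
    G.HasDisjointPaths A B k := by
  have hB' : ∀ b ∈ B, ∀ a ∈ A, ∀ w : G'.Walk b a, ∃ v ∈ w.support, v ∈ S := by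
    intro b hb a ha w
    simpa using hB a ha b hb w.reverse
  refine HasDisjointPaths.of_edge hle hxy hS (hq y q.start_mem_support) hB (ih _ _ ?_)
    (ih _ _ ?_).symm
  · refine h.insert_of_edge hadj hB fun a' ha' w => ?_
    obtain ⟨v, hv, hvS⟩ := hB a' ha' b hb (w.append q)
    rcases Walk.mem_support_append_iff _ _ |>.1 hv with h | h
    · exact ⟨v, h, hvS⟩
    · exact absurd hvS (hq v h)
  · refine h.symm.insert_of_edge (fun u v huv => (hadj u v huv).imp_right Or.symm) hB'
      fun b' hb' w => ?_
    obtain ⟨v, hv, hvS⟩ := hB' b' hb' a ha (w.append p.reverse)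
    rcases Walk.mem_support_append_iff _ _ |>.1 hv with h | h
    · exact ⟨v, h, hvS⟩
    · exact absurd hvS (hp v (by simpa using h))

/-- **Menger's theorem** for sets of vertices, by induction on the number of edges. -/
theorem NotSeparatedBelow.hasDisjointPaths [Finite V] {k : ℕ} (G : SimpleGraph V)
    (A B : Finset V) (h : G.NotSeparatedBelow A B k) : G.HasDisjointPaths A B k := by
  classical
  induction hn : G.edgeSet.ncard using Nat.strong_induction_on generalizing G A B with
  | _ n ih =>
  by_cases hG : G = ⊥
  · subst hG
    have hc : k ≤ (A ∩ B).card := by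
      by_contra! hlt
      obtain ⟨a, ha, b, hb, w, hw⟩ := h _ hlt
      cases w with
      | nil => exact hw a (by simp) (by simp [ha, hb])
      | cons e => exact e.elim
    obtain ⟨f⟩ : Nonempty (Fin k ↪ (A ∩ B : Finset V)) :=
      Function.Embedding.nonempty_of_card_le (by simpa using hc)
    refine ⟨fun i => f i, fun i => f i, fun i => .nil, fun i => .nil,
      fun i => Finset.mem_of_mem_inter_left (f i).2,
      fun i => Finset.mem_of_mem_inter_right (f i).2, fun i j v hi hj => ?_⟩
    simp only [Walk.support_nil, List.mem_singleton] at hi hj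
    exact f.injective (Subtype.ext (hi.symm.trans hj))
  · obtain ⟨x, y, hxy⟩ := G.ne_bot_iff_exists_adj.1 hG
    set G' := G.deleteEdges {s(x, y)} with hG'
    have hle : G' ≤ G := G.deleteEdges_le _
    have hadj : ∀ u v, G.Adj u v → G'.Adj u v ∨ (u = x ∧ v = y) ∨ (u = y ∧ v = x) := by
      intro u v huv
      by_cases he : s(u, v) = s(x, y)
      · right; simpa using he
      · left; simpa [hG', deleteEdges_adj, huv] using he
    have hlt : G'.edgeSet.ncard < n := by
      rw [← hn]
      refine Set.ncard_lt_ncard ?_ (Set.toFinite _)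
      refine (edgeSet_subset_edgeSet.2 hle).ssubset_of_mem_notMem (a := s(x, y)) hxy ?_
      simp [hG']
    have ih' : ∀ (A B : Finset V), G'.NotSeparatedBelow A B k → G'.HasDisjointPaths A B k :=
      fun A B hAB => ih _ hlt G' A B hAB rfl
    by_cases hsep : G'.NotSeparatedBelow A B k
    · obtain ⟨a, b, w, hp, ha, hb, hd⟩ := ih' A B hsep
      exact ⟨a, b, fun i => (w i).mapLe hle, fun i => (hp i).mapLe hle, ha, hb, by simpa using hd⟩
    · unfold NotSeparatedBelow at hsep
      push Not at hsep
      obtain ⟨S, hS, hB⟩ := hsep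
      obtain ⟨a, ha, b, hb, w, hw⟩ := h S hS
      rcases w.exists_walk_of_le_add_edge hadj with ⟨p, hp⟩ | ⟨p, q, hp, hq⟩ | ⟨p, q, hp, hq⟩
      · obtain ⟨v, hv, hvS⟩ := hB a ha b hb p
        exact absurd hvS (hw v (hp hv))
      · exact .of_edge_of_walks hle hxy hadj h hS hB ha hb p q (fun v hv => hw v (hp hv))
          (fun v hv => hw v (hq hv)) ih'
      · exact .of_edge_of_walks hle hxy.symm (fun u v huv => (hadj u v huv).imp_right Or.symm)
          h hS hB ha hb p q (fun v hv => hw v (hp hv)) (fun v hv => hw v (hq hv)) ih'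

end SimpleGraph

/-! ### Longest cycles as cyclic sequences -/

namespace SimpleGraph

variable {V : Type u} {G : SimpleGraph V} {L : ℕ}

/-- A cycle of length `L`, listed as a sequence of distinct vertices indexed by `ZMod L`. (For
`L < 3` this is not a cycle of a simple graph; that `L` is at least `3` is assumed where needed.) -/
structure IsCyclicSeq (G : SimpleGraph V) (c : ZMod L → V) : Prop where
  inj : Function.Injective c
  adj : ∀ i, G.Adj (c i) (c (i + 1))

/-- No cycle of `G` has more than `L` edges. A cycle is given by a path with at least two edges
whose ends are adjacent. -/
def CycleLengthLE (G : SimpleGraph V) (L : ℕ) : Prop :=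
  ∀ ⦃x y : V⦄ (w : G.Walk x y), w.IsPath → G.Adj y x → 2 ≤ w.length → w.length + 1 ≤ L

/-- The vertices that can be reached from `x` by a walk that avoids the cycle `c`: for `x` outside
`c`, the component of `x` in the graph without the cycle. -/
def reachAvoiding (G : SimpleGraph V) (c : ZMod L → V) (x : V) : Set V :=
  {v | ∃ w : G.Walk x v, ∀ u ∈ w.support, u ∉ Set.range c}

open Classical in
/-- The positions on the cycle `c` of the neighbours of a set of vertices. -/
noncomputable def attachments [NeZero L] (G : SimpleGraph V) (c : ZMod L → V) (S : Set V) :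
    Finset (ZMod L) :=
  {i | ∃ v ∈ S, G.Adj v (c i)}

theorem mem_attachments [NeZero L] {c : ZMod L → V} {S : Set V} {i : ZMod L} :
    i ∈ G.attachments c S ↔ ∃ v ∈ S, G.Adj v (c i) := by
  simp [attachments]

theorem attachments_mono [NeZero L] {c : ZMod L → V} {S S' : Set V} (h : S ⊆ S') :
    G.attachments c S ⊆ G.attachments c S' := fun i hi => by
  rw [mem_attachments] at *
  exact hi.imp fun v hv => ⟨h hv.1, hv.2⟩

theorem mem_reachAvoiding_self {c : ZMod L → V} {x : V} (hx : x ∉ Set.range c) :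
    x ∈ G.reachAvoiding c x :=
  ⟨.nil, by simpa using hx⟩

theorem notMem_range_of_mem_reachAvoiding {c : ZMod L → V} {x v : V}
    (h : v ∈ G.reachAvoiding c x) : v ∉ Set.range c := by
  obtain ⟨w, hw⟩ := h
  exact hw v w.end_mem_support

theorem mem_reachAvoiding_of_adj {c : ZMod L → V} {x v v' : V} (h : v ∈ G.reachAvoiding c x)
    (ha : G.Adj v v') (hv' : v' ∉ Set.range c) : v' ∈ G.reachAvoiding c x := by
  obtain ⟨w, hw⟩ := h
  refine ⟨w.concat ha, fun u hu => ?_⟩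
  rw [Walk.support_concat, List.mem_append, List.mem_singleton] at hu
  rcases hu with hu | rfl
  · exact hw u hu
  · exact hv'

theorem mem_reachAvoiding_of_walk {c : ZMod L → V} {x v v' : V} (h : v ∈ G.reachAvoiding c x)
    (w : G.Walk v v') (hw : ∀ u ∈ w.support, u ∉ Set.range c) : v' ∈ G.reachAvoiding c x := by
  obtain ⟨w', hw'⟩ := h
  refine ⟨w'.append w, fun u hu => ?_⟩
  rcases (Walk.mem_support_append_iff _ _).1 hu with hu | hu
  · exact hw' u hu
  · exact hw u hu

theorem exists_walk_of_mem_reachAvoiding {c : ZMod L → V} {x v v' : V}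
    (h : v ∈ G.reachAvoiding c x) (h' : v' ∈ G.reachAvoiding c x) :
    ∃ w : G.Walk v v', ∀ u ∈ w.support, u ∉ Set.range c := by
  obtain ⟨w, hw⟩ := h
  obtain ⟨w', hw'⟩ := h'
  refine ⟨w.reverse.append w', fun u hu => ?_⟩
  rcases (Walk.mem_support_append_iff _ _).1 hu with hu | hu
  · exact hw u (by simpa using hu)
  · exact hw' u hu

theorem reachAvoiding_subset {c : ZMod L → V} {x : V} {S : Set V} (hx : x ∈ S)
    (hS : ∀ v ∈ S, ∀ v', G.Adj v v' → v' ∉ Set.range c → v' ∈ S) :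
    G.reachAvoiding c x ⊆ S := by
  rintro v ⟨w, hw⟩
  induction w with
  | nil => exact hx
  | @cons a b d h w ih =>
    have hw' : ∀ u ∈ w.support, u ∉ Set.range c := fun u hu => hw u (by simp [hu])
    exact ih (hS _ hx _ h (hw' _ w.start_mem_support)) hw'

theorem Walk.IsPath.append_cons {a b d e : V} {p : G.Walk a b} {q : G.Walk d e} (hp : p.IsPath)
    (hq : q.IsPath) (h : G.Adj b d) (hd : ∀ v ∈ p.support, v ∉ q.support) :
    (p.append (.cons h q)).IsPath := by
  rw [Walk.isPath_def, Walk.support_append, Walk.support_cons, List.tail_cons, List.nodup_append]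
  exact ⟨hp.support_nodup, hq.support_nodup, fun u hu v hv e => hd u hu (e ▸ hv)⟩

namespace IsCyclicSeq

variable {c : ZMod L → V}

theorem exists_arc (hc : G.IsCyclicSeq c) (i : ZMod L) (d : ℕ) (hd : d < L) :
    ∃ w : G.Walk (c i) (c (i + (d : ZMod L))), w.IsPath ∧ w.length = d ∧
      ∀ v ∈ w.support, ∃ j ≤ d, v = c (i + (j : ZMod L)) := by
  induction d with
  | zero =>
    refine ⟨Walk.nil.copy rfl (by simp), by simp, by simp, fun v hv => ⟨0, le_rfl, ?_⟩⟩
    simpa using hv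
  | succ d ih =>
    obtain ⟨w, hp, hl, hs⟩ := ih (by omega)
    have e : i + (d : ZMod L) + 1 = i + ((d + 1 : ℕ) : ZMod L) := by push_cast; ring
    have ha : G.Adj (c (i + (d : ZMod L))) (c (i + ((d + 1 : ℕ) : ZMod L))) := e ▸ hc.adj _
    refine ⟨w.concat ha, hp.concat ?_ ha, by simp [hl], fun v hv => ?_⟩
    · intro hv
      obtain ⟨j, hj, hv⟩ := hs _ hv
      have := ZMod.add_natCast_injOn i hd (by omega) (hc.inj hv)
      omega
    · rw [Walk.support_concat, List.mem_append, List.mem_singleton] at hv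
      rcases hv with hv | rfl
      · obtain ⟨j, hj, hv⟩ := hs _ hv
        exact ⟨j, by omega, hv⟩
      · exact ⟨d + 1, le_rfl, rfl⟩

/-- A path outside a longest cycle that joins neighbours of two vertices of the cycle is shorter by
at least two than either arc between them: otherwise it could replace the arc. -/
theorem length_add_two_le (hc : G.IsCyclicSeq c) (hmax : G.CycleLengthLE L) {i : ZMod L} {d : ℕ}
    (hd0 : 0 < d) (hd : d < L) {x y : V} {r : G.Walk x y} (hr : r.IsPath)
    (hout : ∀ v ∈ r.support, v ∉ Set.range c) (hx : G.Adj x (c i))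
    (hy : G.Adj y (c (i + (d : ZMod L)))) : r.length + 2 ≤ d := by
  obtain ⟨w, hp, hl, hs⟩ := hc.exists_arc (i + (d : ZMod L)) (L - d) (by omega)
  have e : i + (d : ZMod L) + ((L - d : ℕ) : ZMod L) = i := by
    rw [Nat.cast_sub hd.le]; simp
  have := hmax (r.append (.cons hy w)) (hr.append_cons hp hy fun v hv hv' => by
    obtain ⟨j, -, rfl⟩ := hs v hv'
    exact hout _ hv ⟨_, rfl⟩) (by rw [e]; exact hx.symm) (by simp [hl]; omega)
  simp [hl] at this
  omega

variable [NeZero L] {T : Finset (ZMod L)}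

theorem length_add_two_le_gap (hc : G.IsCyclicSeq c) (hmax : G.CycleLengthLE L)
    (hT : 1 < T.card) {t : ZMod L} (ht : t ∈ T) {x y : V} {r : G.Walk x y} (hr : r.IsPath)
    (hout : ∀ v ∈ r.support, v ∉ Set.range c) (hx : G.Adj x (c t))
    (hy : G.Adj y (c (ZMod.next T t))) : r.length + 2 ≤ ZMod.gap T t :=
  hc.length_add_two_le hmax (ZMod.gap_spec ht).1 (ZMod.gap_lt hT t) hr hout hx hy

theorem two_le_gap (hc : G.IsCyclicSeq c) (hmax : G.CycleLengthLE L) (hT : 1 < T.card) {x : V}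
    (hTx : T ⊆ G.attachments c (G.reachAvoiding c x)) {t : ZMod L} (ht : t ∈ T) :
    2 ≤ ZMod.gap T t := by
  classical
  obtain ⟨v, hv, ha⟩ := mem_attachments.1 (hTx ht)
  obtain ⟨v', hv', ha'⟩ := mem_attachments.1 (hTx (ZMod.gap_spec ht).2)
  obtain ⟨w, hw⟩ := exists_walk_of_mem_reachAvoiding hv hv'
  have := hc.length_add_two_le_gap hmax hT ht w.bypass_isPath
    (fun u hu => hw u (w.support_bypass_subset_support hu)) ha ha'
  omega

/-- Not all vertices of a longest cycle are attached to the same component outside. -/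
theorem attachments_reachAvoiding_ne_univ (hc : G.IsCyclicSeq c) (hmax : G.CycleLengthLE L)
    (hL : 3 ≤ L) (x : V) : G.attachments c (G.reachAvoiding c x) ≠ Finset.univ := by
  intro h
  have hcard : (Finset.univ : Finset (ZMod L)).card = L := by simp [ZMod.card]
  have := hc.two_le_gap hmax (by omega) h.ge (Finset.mem_univ 0)
  have := ZMod.gap_le (T := Finset.univ) (t := (0 : ZMod L)) one_pos (Finset.mem_univ _)
  omega

end IsCyclicSeq

/-- The closed path given by a path with adjacent ends, as a cyclic sequence. -/
theorem Walk.IsPath.exists_isCyclicSeq {x y : V} {w : G.Walk x y} (hw : w.IsPath)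
    (h : G.Adj y x) (hL : w.length + 1 = L) :
    ∃ c : ZMod L → V, G.IsCyclicSeq c ∧ ∀ v, v ∈ Set.range c ↔ v ∈ w.support := by
  subst hL
  refine ⟨fun i => w.getVert i.val, ⟨fun i j hij => ?_, fun i => ?_⟩, fun v => ?_⟩
  · exact ZMod.val_injective _ (hw.getVert_injOn (Nat.lt_succ_iff.1 (ZMod.val_lt i))
      (Nat.lt_succ_iff.1 (ZMod.val_lt j)) hij)
  · rcases (Nat.lt_succ_iff.1 (ZMod.val_lt i)).lt_or_eq with hi | hi
    · have e : (i + 1).val = i.val + 1 := by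
        have : ((i.val + 1 : ℕ) : ZMod (w.length + 1)) = i + 1 := by simp
        rw [← this, ZMod.val_natCast_of_lt (by omega)]
      simp only [e]
      exact w.adj_getVert_succ hi
    · have e : i + 1 = 0 := by
        have : ((i.val + 1 : ℕ) : ZMod (w.length + 1)) = 0 := by
          rw [hi]; exact ZMod.natCast_self _
        simpa using this
      simp only [e, hi, ZMod.val_zero, Walk.getVert_length, Walk.getVert_zero]
      exact h
  · rw [Walk.mem_support_iff_exists_getVert]
    constructor
    · rintro ⟨i, rfl⟩
      exact ⟨i.val, rfl, Nat.lt_succ_iff.1 (ZMod.val_lt i)⟩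
    · rintro ⟨n, rfl, hn⟩
      exact ⟨(n : ZMod (w.length + 1)), by
        simp only [ZMod.val_natCast_of_lt (Nat.lt_succ_of_le hn)]⟩

/-! ### Connectivity -/

/-- The form of `K`-connectedness that the counting arguments use: fewer than `K` vertices do not
separate the graph, and all degrees are at least `K`. -/
structure WellConnected (G : SimpleGraph V) (K : ℕ) : Prop where
  exists_walk : ∀ X : Finset V, X.card < K → ∀ a b, a ∉ X → b ∉ X →
    ∃ w : G.Walk a b, ∀ v ∈ w.support, v ∉ X
  le_degree : ∀ v, K ≤ (G.neighborSet v).ncard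

theorem WellConnected.le_card_attachments [NeZero L] {K : ℕ} (hG : G.WellConnected K)
    {c : ZMod L → V} (hc : G.IsCyclicSeq c) (hmax : G.CycleLengthLE L) (hL : 3 ≤ L) {x : V}
    (hx : x ∉ Set.range c) : K ≤ (G.attachments c (G.reachAvoiding c x)).card := by
  classical
  set T := G.attachments c (G.reachAvoiding c x) with hT
  by_contra! hlt
  obtain ⟨j, hj⟩ : ∃ j, j ∉ T := by
    by_contra! h
    exact hc.attachments_reachAvoiding_ne_univ hmax hL x (Finset.eq_univ_iff_forall.2 h)
  obtain ⟨w, hw⟩ := hG.exists_walk (T.image c) (Finset.card_image_le.trans_lt hlt) x (c j)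
    (fun h => hx (by obtain ⟨i, -, rfl⟩ := Finset.mem_image.1 h; exact ⟨i, rfl⟩))
    (fun h => hj (by obtain ⟨i, hi, e⟩ := Finset.mem_image.1 h; rwa [← hc.inj e]))
  have key : ∀ {v u : V} (w : G.Walk v u), v ∈ G.reachAvoiding c x →
      (∀ z ∈ w.support, z ∉ T.image c) → u ∈ G.reachAvoiding c x := by
    intro v u w
    induction w with
    | nil => exact fun h _ => h
    | @cons a b d h w ih =>
      intro hv hw
      refine ih (mem_reachAvoiding_of_adj hv h ?_) fun z hz => hw z (by simp [hz])
      rintro ⟨i, rfl⟩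
      exact hw (c i) (by simp) (Finset.mem_image_of_mem c (mem_attachments.2 ⟨_, hv, h⟩))
  exact notMem_range_of_mem_reachAvoiding (key w (mem_reachAvoiding_self hx) hw) ⟨j, rfl⟩

/-- `2 K` is a lower bound for the length of a longest cycle that is not Hamiltonian. -/
theorem WellConnected.two_mul_le [NeZero L] {K : ℕ} (hG : G.WellConnected K) (hK : 2 ≤ K)
    {c : ZMod L → V} (hc : G.IsCyclicSeq c) (hmax : G.CycleLengthLE L) (hL : 3 ≤ L) {x : V}
    (hx : x ∉ Set.range c) : 2 * K ≤ L := by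
  have hT := hG.le_card_attachments hc hmax hL hx
  have := ZMod.two_mul_card_add_le (e := 0) (Finset.empty_subset _)
    (fun t ht => hc.two_le_gap hmax (hK.trans hT) subset_rfl ht) (by simp)
  omega

end SimpleGraph

/-! ### A cycle outside a longest cycle -/

namespace SimpleGraph

variable {V : Type u} {G : SimpleGraph V} {L q : ℕ}

theorem Walk.IsPath.append_of_inter {a b d : V} {p : G.Walk a b} {r : G.Walk b d} (hp : p.IsPath)
    (hr : r.IsPath) (h : ∀ v ∈ p.support, v ∈ r.support → v = b) : (p.append r).IsPath := by
  rw [Walk.isPath_def, Walk.support_append, List.nodup_append]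
  refine ⟨hp.support_nodup, hr.support_nodup.tail, fun u hu v hv e => ?_⟩
  subst e
  have := h u hu (List.mem_of_mem_tail hv)
  subst this
  have hn := hr.support_nodup
  rw [← Walk.cons_tail_support] at hn
  exact (List.nodup_cons.1 hn).1 hv

theorem Walk.exists_isPath_first_hit {S : Set V} {a b : V} (w : G.Walk a b) (hb : b ∈ S) :
    ∃ d ∈ S, ∃ p : G.Walk a d, p.IsPath ∧ (∀ v ∈ p.support, v ∈ w.support) ∧
      ∀ v ∈ p.support, v ∈ S → v = d := by
  classical
  suffices h : ∃ d ∈ S, ∃ p : G.Walk a d, (∀ v ∈ p.support, v ∈ w.support) ∧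
      ∀ v ∈ p.support, v ∈ S → v = d by
    obtain ⟨d, hd, p, h1, h2⟩ := h
    exact ⟨d, hd, p.bypass, p.bypass_isPath, fun v hv => h1 v (p.support_bypass_subset_support hv),
      fun v hv => h2 v (p.support_bypass_subset_support hv)⟩
  induction w with
  | nil => exact ⟨_, hb, .nil, by simp, by simp⟩
  | @cons a c b h w ih =>
    by_cases ha : a ∈ S
    · exact ⟨a, ha, .nil, by simp, by simp⟩
    obtain ⟨d, hd, p, h1, h2⟩ := ih hb
    refine ⟨d, hd, .cons h p, fun v hv => ?_, fun v hv hvS => ?_⟩ <;>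
      rw [Walk.support_cons, List.mem_cons] at hv <;> rcases hv with rfl | hv
    · simp
    · simp [h1 v hv]
    · exact absurd hvS ha
    · exact h2 v hv hvS

theorem Walk.exists_walk_before_hit {S : Set V} {a b : V} (w : G.Walk a b) (ha : a ∉ S)
    (hb : b ∈ S) : ∃ d ∈ S, d ∈ w.support ∧ ∃ (e : V) (p : G.Walk a e), G.Adj e d ∧
      ∀ v ∈ p.support, v ∈ w.support ∧ v ∉ S := by
  induction w with
  | nil => exact absurd hb ha
  | @cons a c b h w ih =>
    by_cases hc : c ∈ S
    · exact ⟨c, hc, by simp, a, .nil, h, by simpa using ha⟩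
    obtain ⟨d, hd, hdw, e, p, hed, hp⟩ := ih hc hb
    refine ⟨d, hd, by simp [hdw], e, .cons h p, hed, fun v hv => ?_⟩
    rw [Walk.support_cons, List.mem_cons] at hv
    rcases hv with rfl | hv
    · exact ⟨by simp, ha⟩
    · exact ⟨by simp [(hp v hv).1], (hp v hv).2⟩

/-- Two vertices of a cycle are joined by an arc with at least half of its edges. -/
theorem IsCyclicSeq.exists_long_arc [NeZero q] {z : ZMod q → V} (hz : G.IsCyclicSeq z)
    {i j : ZMod q} (hij : i ≠ j) : ∃ w : G.Walk (z i) (z j), w.IsPath ∧ (q + 1) / 2 ≤ w.length ∧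
      ∀ v ∈ w.support, v ∈ Set.range z := by
  obtain ⟨d, hd, rfl⟩ := ZMod.exists_natCast_add_eq i j
  have hd0 : d ≠ 0 := by rintro rfl; simp at hij
  by_cases h : (q + 1) / 2 ≤ d
  · obtain ⟨w, hp, hl, hs⟩ := hz.exists_arc i d hd
    exact ⟨w, hp, by omega, fun v hv => by obtain ⟨j, -, rfl⟩ := hs v hv; exact ⟨_, rfl⟩⟩
  · obtain ⟨w, hp, hl, hs⟩ := hz.exists_arc (i + (d : ZMod q)) (q - d) (by omega)
    have e : i + (d : ZMod q) + ((q - d : ℕ) : ZMod q) = i := by rw [Nat.cast_sub hd.le]; simp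
    refine ⟨(w.copy rfl (by rw [e])).reverse, by simpa using hp, ?_, fun v hv => ?_⟩
    · simp [hl]; omega
    · obtain ⟨j, -, rfl⟩ := hs v (by simpa using hv)
      exact ⟨_, rfl⟩

/-- The vertices at the positions `i ≠ j` of the cycle `c` have neighbours from which disjoint walks
outside `c` lead to the cycle `z`. -/
def LinkedTo (G : SimpleGraph V) (c : ZMod L → V) (z : ZMod q → V) (i j : ZMod L) : Prop :=
  i ≠ j ∧ ∃ (u a v b : V) (w : G.Walk u a) (w' : G.Walk v b), G.Adj u (c i) ∧ G.Adj v (c j) ∧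
    a ∈ Set.range z ∧ b ∈ Set.range z ∧ (∀ x ∈ w.support, x ∉ Set.range c) ∧
    (∀ x ∈ w'.support, x ∉ Set.range c) ∧ ∀ x ∈ w.support, x ∉ w'.support

theorem LinkedTo.symm {c : ZMod L → V} {z : ZMod q → V} {i j : ZMod L}
    (h : G.LinkedTo c z i j) : G.LinkedTo c z j i := by
  obtain ⟨hij, u, a, v, b, w, w', hu, hv, ha, hb, hw, hw', hd⟩ := h
  exact ⟨hij.symm, v, b, u, a, w', w, hv, hu, hb, ha, hw', hw, fun x hx hx' => hd x hx' hx⟩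

/-- Given disjoint walks `w`, `w'` to `Z`, every vertex that has a walk to `Z` has one that avoids
`w` or avoids `w'`: follow the given walk until it meets `w` or `w'`, and then that one. -/
theorem Walk.exists_walk_avoiding_one_of_two {S Z : Set V} {u a v b : V} (w : G.Walk u a)
    (w' : G.Walk v b) (ha : a ∈ Z) (hb : b ∈ Z) (hw : ∀ x ∈ w.support, x ∉ S)
    (hw' : ∀ x ∈ w'.support, x ∉ S) (hd : ∀ x ∈ w.support, x ∉ w'.support) {s t : V}
    (p : G.Walk s t) (ht : t ∈ Z) (hp : ∀ x ∈ p.support, x ∉ S) :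
    ∃ e ∈ Z, ∃ r : G.Walk s e, (∀ x ∈ r.support, x ∉ S) ∧
      ((∀ x ∈ w.support, x ∉ r.support) ∨ ∀ x ∈ r.support, x ∉ w'.support) := by
  classical
  induction p with
  | @nil s =>
    by_cases hs : s ∈ w.support
    · exact ⟨s, ht, .nil, hp, Or.inr (by simpa using hd s hs)⟩
    · exact ⟨s, ht, .nil, hp, Or.inl fun x hx hx' => hs (by simp at hx'; rwa [← hx'])⟩
  | @cons s y t h p ih =>
    by_cases hs : s ∈ w.support
    · have hsub := w.support_dropUntil_subset_support hs
      exact ⟨a, ha, w.dropUntil s hs, fun x hx => hw x (hsub hx),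
        Or.inr fun x hx => hd x (hsub hx)⟩
    by_cases hs' : s ∈ w'.support
    · have hsub := w'.support_dropUntil_subset_support hs'
      exact ⟨b, hb, w'.dropUntil s hs', fun x hx => hw' x (hsub hx),
        Or.inl fun x hx hx' => hd x hx (hsub hx')⟩
    obtain ⟨e, he, r, hr, hdis⟩ := ih ht fun x hx => hp x (by simp [hx])
    refine ⟨e, he, .cons h r, fun x hx => ?_, ?_⟩
    · rw [Walk.support_cons, List.mem_cons] at hx
      rcases hx with rfl | hx
      · exact hp x (by simp)
      · exact hr x hx
    · refine hdis.imp (fun hdis x hx hx' => ?_) fun hdis x hx => ?_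
      · rw [Walk.support_cons, List.mem_cons] at hx'
        rcases hx' with rfl | hx'
        · exact hs hx
        · exact hdis x hx hx'
      · rw [Walk.support_cons, List.mem_cons] at hx
        rcases hx with rfl | hx
        · exact hs'
        · exact hdis x hx

/-- Not being linked is transitive among the attachments of the component that contains `z`: a walk
from a third attachment to `z` can be made to avoid one of two disjoint ones. -/
theorem LinkedTo.or_of_mem_attachments [NeZero L] [NeZero q] {c : ZMod L → V} {z : ZMod q → V}
    {x : V} (hz : ∀ k, z k ∈ G.reachAvoiding c x) {i j : ZMod L} (h : G.LinkedTo c z i j)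
    {t : ZMod L} (ht : t ∈ G.attachments c (G.reachAvoiding c x)) :
    G.LinkedTo c z i t ∨ G.LinkedTo c z t j := by
  by_cases hti : t = i
  · exact Or.inr (hti ▸ h)
  by_cases htj : t = j
  · exact Or.inl (htj ▸ h)
  obtain ⟨hij, u, a, v, b, w, w', hu, hv, ha, hb, hw, hw', hd⟩ := h
  obtain ⟨s, hs, hst⟩ := mem_attachments.1 ht
  obtain ⟨p, hp⟩ := exists_walk_of_mem_reachAvoiding hs (hz 0)
  obtain ⟨e, he, r, hr, hdis | hdis⟩ :=
    w.exists_walk_avoiding_one_of_two w' ha hb hw hw' hd p ⟨0, rfl⟩ hp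
  · exact Or.inl ⟨Ne.symm hti, u, a, s, e, w, r, hu, hst, ha, he, hw, hr, hdis⟩
  · exact Or.inr ⟨htj, s, e, v, b, r, w', hst, hv, he, hb, hr, hw', hdis⟩

/-- Linked positions are joined by a path outside `c` along the longer of two arcs of `z`. -/
theorem LinkedTo.exists_isPath [NeZero q] {c : ZMod L → V} {z : ZMod q → V}
    (hz : G.IsCyclicSeq z) (hzc : ∀ k, z k ∉ Set.range c) {i j : ZMod L}
    (h : G.LinkedTo c z i j) : ∃ (u v : V) (r : G.Walk u v), r.IsPath ∧ (q + 1) / 2 ≤ r.length ∧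
      G.Adj u (c i) ∧ G.Adj v (c j) ∧ ∀ x ∈ r.support, x ∉ Set.range c := by
  obtain ⟨-, u, a, v, b, w, w', hu, hv, ha, hb, hw, hw', hd⟩ := h
  obtain ⟨a, ⟨k, rfl⟩, p, hp, hps, hpz⟩ := w.exists_isPath_first_hit ha
  obtain ⟨b, ⟨l, rfl⟩, p', hp', hps', hpz'⟩ := w'.exists_isPath_first_hit hb
  have hdp : ∀ x ∈ p.support, x ∉ p'.support := fun x hx hx' => hd x (hps x hx) (hps' x hx')
  have hkl : k ≠ l := by
    rintro rfl
    exact hdp _ p.end_mem_support p'.end_mem_support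
  obtain ⟨m, hm, hml, hms⟩ := hz.exists_long_arc hkl
  refine ⟨u, v, (p.append m).append p'.reverse, ?_, ?_, hu, hv, fun x hx => ?_⟩
  · refine (hp.append_of_inter hm fun x hx hx' => hpz x hx (hms x hx')).append_of_inter
      hp'.reverse fun x hx hx' => ?_
    rw [Walk.support_reverse, List.mem_reverse] at hx'
    rcases (Walk.mem_support_append_iff _ _).1 hx with hx | hx
    · exact absurd hx' (hdp x hx)
    · exact hpz' x hx' (hms x hx)
  · simp; omega
  · simp only [Walk.mem_support_append_iff, Walk.support_reverse, List.mem_reverse] at hx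
    rcases hx with (hx | hx) | hx
    · exact hw x (hps x hx)
    · obtain ⟨k, rfl⟩ := hms x hx
      exact hzc k
    · exact hw' x (hps' x hx)

/-- The disjoint paths from `z` to `c` that Menger's theorem gives, cut off where they first meet
`c`, show that some `min q K` positions on `c` are pairwise linked to `z`. -/
theorem exists_pairwise_linkedTo [Finite V] [NeZero L] [NeZero q] {c : ZMod L → V}
    {z : ZMod q → V} {K : ℕ} (hG : G.WellConnected K) (hc : G.IsCyclicSeq c)
    (hz : G.IsCyclicSeq z) (hKL : K ≤ L) {x : V} (hzx : ∀ k, z k ∈ G.reachAvoiding c x) :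
    ∃ p : Fin (min q K) → ZMod L, (∀ i, p i ∈ G.attachments c (G.reachAvoiding c x)) ∧
      ∀ i j, i ≠ j → G.LinkedTo c z (p i) (p j) := by
  classical
  have hcard : ∀ {n : ℕ} [NeZero n] {f : ZMod n → V}, Function.Injective f →
      ∀ X : Finset V, X.card < n → ∃ a ∈ Finset.univ.image f, a ∉ X := by
    intro n _ f hf X hX
    by_contra! h
    have := Finset.card_le_card h
    rw [Finset.card_image_of_injective _ hf, Finset.card_univ, ZMod.card] at this
    omega
  obtain ⟨a, b, w, -, ha, hb, hd⟩ := NotSeparatedBelow.hasDisjointPaths (k := min q K) G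
    (Finset.univ.image z) (Finset.univ.image c) (by
      intro X hX
      obtain ⟨a, ha, haX⟩ := hcard hz.inj X (by omega)
      obtain ⟨b, hb, hbX⟩ := hcard hc.inj X (by omega)
      exact ⟨a, ha, b, hb, hG.exists_walk X (by omega) a b haX hbX⟩)
  have haz : ∀ i, a i ∈ Set.range z := fun i => by simpa using ha i
  have hac : ∀ i, a i ∈ G.reachAvoiding c x := fun i => by
    obtain ⟨k, hk⟩ := haz i
    exact hk ▸ hzx k
  have key : ∀ i, ∃ p : ZMod L, c p ∈ (w i).support ∧ ∃ (e : V) (r : G.Walk (a i) e),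
      G.Adj e (c p) ∧ ∀ v ∈ r.support, v ∈ (w i).support ∧ v ∉ Set.range c := by
    intro i
    obtain ⟨_, ⟨p, rfl⟩, h⟩ := (w i).exists_walk_before_hit
      (notMem_range_of_mem_reachAvoiding (hac i)) (show b i ∈ Set.range c by simpa using hb i)
    exact ⟨p, h⟩
  choose p hp e r hr hrs using key
  refine ⟨p, fun i => mem_attachments.2 ⟨e i, ?_, hr i⟩, fun i j hij => ⟨fun h => ?_, ?_⟩⟩
  · exact mem_reachAvoiding_of_walk (hac i) (r i) fun u hu => (hrs i u hu).2
  · exact hij (hd i j _ (hp i) (h ▸ hp j))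
  · refine ⟨e i, a i, e j, a j, (r i).reverse, (r j).reverse, hr i, hr j, haz i, haz j, ?_, ?_, ?_⟩
    · simpa using fun u hu => (hrs i u hu).2
    · simpa using fun u hu => (hrs j u hu).2
    · intro u hu hu'
      rw [Walk.support_reverse, List.mem_reverse] at hu hu'
      exact hij (hd i j u (hrs i u hu).1 (hrs j u hu').1)

/-- A cycle of length `q` outside a longest cycle forces `min q K` of the gaps between attachments
to be longer than half of it. -/
theorem WellConnected.two_mul_card_attachments_add_le [Finite V] [NeZero L] [NeZero q]
    {c : ZMod L → V} {z : ZMod q → V} {K : ℕ} (hG : G.WellConnected K) (hK : 2 ≤ K)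
    (hc : G.IsCyclicSeq c) (hmax : G.CycleLengthLE L) (hL : 3 ≤ L) (hz : G.IsCyclicSeq z)
    (hq : 2 ≤ q) {x : V} (hx : x ∉ Set.range c) (hzx : ∀ k, z k ∈ G.reachAvoiding c x) :
    2 * (G.attachments c (G.reachAvoiding c x)).card + ((q + 1) / 2) * min q K ≤ L := by
  classical
  set T := G.attachments c (G.reachAvoiding c x) with hTdef
  have hT : 1 < T.card := hK.trans (hG.le_card_attachments hc hmax hL hx)
  obtain ⟨p, hpT, hp⟩ := exists_pairwise_linkedTo hG hc hz
    (by have := hG.two_mul_le hK hc hmax hL hx; omega) hzx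
  -- For each `i`, go along `T` until the last position before one that is linked to `p i`.
  have hex : ∀ i, ∃ t ∈ T, ¬ G.LinkedTo c z (p i) t ∧ G.LinkedTo c z t (ZMod.next T t) := by
    intro i
    have : Nontrivial (Fin (min q K)) := Fin.nontrivial_iff_two_le.2 (by omega)
    obtain ⟨j, hj⟩ := exists_ne i
    obtain ⟨t, ht, hn, hnt⟩ := ZMod.exists_next_notMem
      (T := T) (U := T.filter fun t => ¬ G.LinkedTo c z (p i) t) (Finset.filter_subset _ _)
      ⟨p i, Finset.mem_filter.2 ⟨hpT i, fun h => h.1 rfl⟩⟩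
      (fun h => (Finset.mem_filter.1 (h.ge (hpT j))).2 (hp i j hj.symm))
    rw [Finset.mem_filter] at ht hnt
    have hl : G.LinkedTo c z (p i) (ZMod.next T t) := by
      by_contra h; exact hnt ⟨hn, h⟩
    exact ⟨t, ht.1, ht.2, (hl.or_of_mem_attachments hzx ht.1).resolve_left ht.2⟩
  choose t htT hnl hl using hex
  have hinj : Function.Injective t := by
    intro i j hij
    by_contra hne
    rcases (hp i j hne).or_of_mem_attachments hzx (htT i) with h | h
    · exact hnl i h
    · exact hnl j (hij ▸ h.symm)
  have := ZMod.two_mul_card_add_le (T := T) (W := Finset.univ.image t) (e := (q + 1) / 2)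
    (by intro s hs; obtain ⟨i, -, rfl⟩ := Finset.mem_image.1 hs; exact htT i)
    (fun s hs => hc.two_le_gap hmax hT subset_rfl hs) (by
      intro s hs
      obtain ⟨i, -, rfl⟩ := Finset.mem_image.1 hs
      obtain ⟨u, v, r, hr, hrl, hu, hv, hrc⟩ := (hl i).exists_isPath hz
        fun k => notMem_range_of_mem_reachAvoiding (hzx k)
      have := hc.length_add_two_le_gap hmax hT (htT i) hr hrc hu hv
      omega)
  rwa [Finset.card_image_of_injective _ hinj, Finset.card_univ, Fintype.card_fin] at this

end SimpleGraph

/-! ### A longest path outside a longest cycle -/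

namespace SimpleGraph

variable {V : Type u} {G : SimpleGraph V} {L : ℕ}

theorem mem_attachments_singleton [NeZero L] {c : ZMod L → V} {x : V} {i : ZMod L} :
    i ∈ G.attachments c {x} ↔ G.Adj x (c i) := by
  simp [mem_attachments]

/-- The walk `r` is a path that avoids the cycle `c`, and no longer path does. -/
structure IsLongestOutside (G : SimpleGraph V) (c : ZMod L → V) {x y : V} (r : G.Walk x y) :
    Prop where
  isPath : r.IsPath
  avoids : ∀ v ∈ r.support, v ∉ Set.range c
  length_le : ∀ ⦃u v : V⦄ (w : G.Walk u v), w.IsPath → (∀ s ∈ w.support, s ∉ Set.range c) →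
    w.length ≤ r.length

theorem exists_isLongestOutside [Finite V] (c : ZMod L → V) {x : V} (hx : x ∉ Set.range c) :
    ∃ (u v : V) (r : G.Walk u v), G.IsLongestOutside c r := by
  classical
  cases nonempty_fintype V
  let P : ℕ → Prop := fun n => ∃ (u v : V) (r : G.Walk u v), r.IsPath ∧
    (∀ s ∈ r.support, s ∉ Set.range c) ∧ r.length = n
  have h0 : P 0 := ⟨x, x, .nil, .nil, by simpa using hx, rfl⟩
  obtain ⟨u, v, r, hr, hrc, hn⟩ :=
    Nat.findGreatest_spec (P := P) (Nat.zero_le (Fintype.card V)) h0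
  refine ⟨u, v, r, hr, hrc, fun u' v' w hw hwc => ?_⟩
  rw [hn]
  exact Nat.le_findGreatest hw.length_lt.le ⟨u', v', w, hw, hwc, rfl⟩

namespace IsLongestOutside

variable {c : ZMod L → V} {x y : V} {r : G.Walk x y}

theorem reverse (hr : G.IsLongestOutside c r) : G.IsLongestOutside c r.reverse :=
  ⟨hr.isPath.reverse, by simpa using hr.avoids, by simpa using hr.length_le⟩

theorem mem_support_of_adj (hr : G.IsLongestOutside c r) {v : V} (h : G.Adj x v)
    (hv : v ∉ Set.range c) : v ∈ r.support := by
  by_contra hvs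
  have := hr.length_le (.cons h.symm r) (hr.isPath.cons hvs) (by
    intro s hs
    rw [Walk.support_cons, List.mem_cons] at hs
    rcases hs with rfl | hs
    · exact hv
    · exact hr.avoids s hs)
  simp at this

theorem start_notMem (hr : G.IsLongestOutside c r) : x ∉ Set.range c :=
  hr.avoids x r.start_mem_support

theorem mem_reachAvoiding (hr : G.IsLongestOutside c r) {v : V} (hv : v ∈ r.support) :
    v ∈ G.reachAvoiding c x := by
  classical
  exact ⟨r.takeUntil v hv, fun u hu => hr.avoids u (r.support_takeUntil_subset_support hv hu)⟩

theorem reachAvoiding_reverse (hr : G.IsLongestOutside c r) :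
    G.reachAvoiding c y = G.reachAvoiding c x := by
  have hy := hr.mem_reachAvoiding r.end_mem_support
  have hx := hr.reverse.mem_reachAvoiding r.reverse.end_mem_support
  ext v
  constructor <;> rintro ⟨w, hw⟩
  · exact mem_reachAvoiding_of_walk hy w hw
  · exact mem_reachAvoiding_of_walk hx w hw

theorem attachments_start_subset [NeZero L] (hr : G.IsLongestOutside c r) :
    G.attachments c {x} ⊆ G.attachments c (G.reachAvoiding c x) :=
  attachments_mono (by simpa using mem_reachAvoiding_self hr.start_notMem)

theorem attachments_end_subset [NeZero L] (hr : G.IsLongestOutside c r) :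
    G.attachments c {y} ⊆ G.attachments c (G.reachAvoiding c x) :=
  hr.reachAvoiding_reverse ▸ hr.reverse.attachments_start_subset

/-- The neighbours of the start of a longest path outside the cycle lie on that path. If the last
of them is at distance `j` along the path, there are at most `j`. -/
theorem exists_last_neighbor [Finite V] [NeZero L] {K : ℕ} (hG : G.WellConnected K)
    (hr : G.IsLongestOutside c r) (hr1 : 1 ≤ r.length) :
    ∃ j, 1 ≤ j ∧ j ≤ r.length ∧ G.Adj x (r.getVert j) ∧
      K ≤ (G.attachments c {x}).card + j := by
  classical
  let P : ℕ → Prop := fun j => G.Adj x (r.getVert j)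
  have h1 : P 1 := by
    have := r.adj_getVert_succ (i := 0) (by omega)
    simpa [P] using this
  set j := Nat.findGreatest P r.length with hj
  have hjP : P j := Nat.findGreatest_spec hr1 h1
  refine ⟨j, Nat.le_findGreatest hr1 h1, Nat.findGreatest_le _, hjP, ?_⟩
  have hsub : G.neighborSet x ⊆
      ↑((G.attachments c {x}).image c ∪ (Finset.Icc 1 j).image r.getVert) := by
    intro v hv
    rw [mem_neighborSet] at hv
    rw [Finset.mem_coe, Finset.mem_union]
    by_cases hvc : v ∈ Set.range c
    · obtain ⟨i, rfl⟩ := hvc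
      exact Or.inl (Finset.mem_image_of_mem c (mem_attachments_singleton.2 hv))
    · obtain ⟨n, rfl, hn⟩ := Walk.mem_support_iff_exists_getVert.1 (hr.mem_support_of_adj hv hvc)
      refine Or.inr (Finset.mem_image_of_mem _ (Finset.mem_Icc.2 ⟨?_, Nat.le_findGreatest hn hv⟩))
      rcases Nat.eq_zero_or_pos n with rfl | h
      · simp at hv
      · exact h
  have h2 := (hG.le_degree x).trans (Set.ncard_le_ncard hsub)
  rw [Set.ncard_coe_finset] at h2
  have h3 := Finset.card_union_le ((G.attachments c {x}).image c) ((Finset.Icc 1 j).image r.getVert)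
  have h4 := Finset.card_image_le (s := G.attachments c {x}) (f := c)
  have h5 := Finset.card_image_le (s := Finset.Icc 1 j) (f := r.getVert)
  rw [Nat.card_Icc] at h5
  omega

/-- With `q - 1` the largest distance along the path from one of its ends to a neighbour of that
end, both ends have at least `K + 1 - q` neighbours on the cycle, and if `q` is at least `3` there
is a cycle of length `q` on the path. -/
theorem exists_bounds [Finite V] [NeZero L] {K : ℕ} (hG : G.WellConnected K) (hK : 2 ≤ K)
    (hc : G.IsCyclicSeq c) (hmax : G.CycleLengthLE L) (hL : 3 ≤ L)
    (hr : G.IsLongestOutside c r) (hr1 : 1 ≤ r.length) :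
    ∃ q, 2 ≤ q ∧ q ≤ r.length + 1 ∧ (q = r.length + 1 → G.Adj x y) ∧
      K + 1 ≤ (G.attachments c {x}).card + q ∧ K + 1 ≤ (G.attachments c {y}).card + q ∧
      (3 ≤ q → 2 * (G.attachments c (G.reachAvoiding c x)).card + ((q + 1) / 2) * min q K ≤ L) := by
  have main : ∀ {x y : V} {r : G.Walk x y}, G.IsLongestOutside c r → ∀ j, 1 ≤ j → j ≤ r.length →
      G.Adj x (r.getVert j) → (j = r.length → G.Adj x y) ∧ (3 ≤ j + 1 →
      2 * (G.attachments c (G.reachAvoiding c x)).card + ((j + 1 + 1) / 2) * min (j + 1) K ≤ L)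
      := by
    intro x y r hr j hj1 hj hadj
    refine ⟨?_, fun h3 => ?_⟩
    · rintro rfl
      simpa using hadj
    · obtain ⟨z, hz, hzs⟩ := (hr.isPath.take j).exists_isCyclicSeq (L := j + 1) hadj.symm
        (by simp [hj])
      refine hG.two_mul_card_attachments_add_le hK hc hmax hL hz (by omega) hr.start_notMem ?_
      exact fun k => hr.mem_reachAvoiding
        ((r.isSubwalk_take j).support_subset ((hzs _).1 ⟨k, rfl⟩))
  obtain ⟨j, hj1, hj, hjadj, hjK⟩ := hr.exists_last_neighbor hG hr1
  obtain ⟨j', hj1', hj', hjadj', hjK'⟩ := hr.reverse.exists_last_neighbor hG (by simpa using hr1)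
  rw [Walk.length_reverse] at hj'
  rcases le_total j' j with h | h
  · obtain ⟨h1, h2⟩ := main hr j hj1 hj hjadj
    exact ⟨j + 1, by omega, by omega, fun e => h1 (by omega), by omega, by omega, h2⟩
  · obtain ⟨h1, h2⟩ := main hr.reverse j' hj1' (by simpa using hj') hjadj'
    rw [hr.reachAvoiding_reverse] at h2
    exact ⟨j' + 1, by omega, by omega, fun e => (h1 (by simp; omega)).symm, by omega, by omega, h2⟩

/-- The gaps between a neighbour of one end of the path and a neighbour of the other are longer than
the path. -/
theorem two_mul_card_union_add_le [NeZero L] (hc : G.IsCyclicSeq c) (hmax : G.CycleLengthLE L)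
    (hr : G.IsLongestOutside c r) {T W : Finset (ZMod L)}
    (hT : T = G.attachments c {x} ∪ G.attachments c {y}) (hT2 : 1 < T.card) (hW : W ⊆ T)
    (h : ∀ t ∈ W, (t ∈ G.attachments c {x} ∧ ZMod.next T t ∈ G.attachments c {y}) ∨
      (t ∈ G.attachments c {y} ∧ ZMod.next T t ∈ G.attachments c {x})) :
    2 * T.card + r.length * W.card ≤ L := by
  refine ZMod.two_mul_card_add_le hW (fun t ht => hc.two_le_gap hmax hT2 (x := x) ?_ ht)
    fun t ht => ?_
  · rw [hT]
    exact Finset.union_subset hr.attachments_start_subset hr.attachments_end_subset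
  · simp only [mem_attachments_singleton] at h
    rcases h t ht with ⟨h1, h2⟩ | ⟨h1, h2⟩
    · exact hc.length_add_two_le_gap hmax hT2 (hW ht) hr.isPath hr.avoids h1 h2
    · have := hc.length_add_two_le_gap hmax hT2 (hW ht) hr.reverse.isPath hr.reverse.avoids h1 h2
      simpa using this

/-- A gap that starts in a common neighbour of both ends is long, since the next element is a
neighbour of one end or the other. -/
theorem two_mul_card_union_add_inter_le [NeZero L] (hc : G.IsCyclicSeq c)
    (hmax : G.CycleLengthLE L) (hr : G.IsLongestOutside c r)
    (h2 : 1 < (G.attachments c {x} ∪ G.attachments c {y}).card) :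
    2 * (G.attachments c {x} ∪ G.attachments c {y}).card +
      r.length * (G.attachments c {x} ∩ G.attachments c {y}).card ≤ L := by
  refine hr.two_mul_card_union_add_le hc hmax rfl h2
    (Finset.inter_subset_left.trans Finset.subset_union_left) fun t ht => ?_
  rw [Finset.mem_inter] at ht
  have hn := (ZMod.gap_spec (Finset.mem_union_left (G.attachments c {y}) ht.1)).2
  rcases Finset.mem_union.1 hn with h | h
  · exact Or.inr ⟨ht.2, h⟩
  · exact Or.inl ⟨ht.1, h⟩

/-- If the ends of the path have common neighbours on the cycle, but not only these, then one more
gap is long: one that ends in a common neighbour, but does not start in one. -/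
theorem two_mul_card_union_add_inter_succ_le [NeZero L] (hc : G.IsCyclicSeq c)
    (hmax : G.CycleLengthLE L) (hr : G.IsLongestOutside c r)
    (h2 : 1 < (G.attachments c {x} ∪ G.attachments c {y}).card)
    (hne : G.attachments c {x} ≠ G.attachments c {y})
    (hi : (G.attachments c {x} ∩ G.attachments c {y}).Nonempty) :
    2 * (G.attachments c {x} ∪ G.attachments c {y}).card +
      r.length * ((G.attachments c {x} ∩ G.attachments c {y}).card + 1) ≤ L := by
  set A := G.attachments c {x}
  set B := G.attachments c {y}
  have hIT : A ∩ B ⊆ A ∪ B := Finset.inter_subset_left.trans Finset.subset_union_left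
  obtain ⟨t, ht, hn, hnt⟩ := ZMod.exists_next_notMem (T := A ∪ B) (U := (A ∪ B) \ (A ∩ B))
    Finset.sdiff_subset (by
      rw [Finset.sdiff_nonempty]
      intro h
      refine hne (Finset.Subset.antisymm (fun s hs => ?_) fun s hs => ?_)
      · exact (Finset.mem_inter.1 (h (Finset.mem_union_left _ hs))).2
      · exact (Finset.mem_inter.1 (h (Finset.mem_union_right _ hs))).1) (by
      intro h
      obtain ⟨s, hs⟩ := hi
      exact (Finset.mem_sdiff.1 (h.ge (hIT hs))).2 hs)
  rw [Finset.mem_sdiff] at ht hnt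
  have hn' : ZMod.next (A ∪ B) t ∈ A ∩ B := by
    by_contra h
    exact hnt ⟨hn, h⟩
  rw [← Finset.card_insert_of_notMem ht.2]
  refine hr.two_mul_card_union_add_le hc hmax rfl h2
    (Finset.insert_subset ht.1 hIT) fun s hs => ?_
  rcases Finset.mem_insert.1 hs with rfl | hs
  · rw [Finset.mem_inter] at hn'
    rcases Finset.mem_union.1 ht.1 with h | h
    · exact Or.inl ⟨h, hn'.2⟩
    · exact Or.inr ⟨h, hn'.1⟩
  · rw [Finset.mem_inter] at hs
    have hn := (ZMod.gap_spec (Finset.mem_union_left B hs.1)).2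
    rcases Finset.mem_union.1 hn with h | h
    · exact Or.inr ⟨hs.2, h⟩
    · exact Or.inl ⟨hs.1, h⟩

/-- If the ends of the path have no common neighbours on the cycle, then a gap from the neighbours
of one to those of the other and a gap back are long. -/
theorem two_mul_card_union_add_two_mul_le [NeZero L] (hc : G.IsCyclicSeq c)
    (hmax : G.CycleLengthLE L) (hr : G.IsLongestOutside c r)
    (h2 : 1 < (G.attachments c {x} ∪ G.attachments c {y}).card)
    (hx : (G.attachments c {x}).Nonempty) (hy : (G.attachments c {y}).Nonempty)
    (hd : Disjoint (G.attachments c {x}) (G.attachments c {y})) :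
    2 * (G.attachments c {x} ∪ G.attachments c {y}).card + r.length * 2 ≤ L := by
  set A := G.attachments c {x}
  set B := G.attachments c {y}
  rw [Finset.disjoint_left] at hd
  obtain ⟨t, ht, hn, hnt⟩ := ZMod.exists_next_notMem (T := A ∪ B) (U := A)
    Finset.subset_union_left hx (by
      intro h
      obtain ⟨s, hs⟩ := hy
      exact hd (h.ge (Finset.mem_union_right _ hs)) hs)
  obtain ⟨t', ht', hn', hnt'⟩ := ZMod.exists_next_notMem (T := A ∪ B) (U := B)
    Finset.subset_union_right hy (by
      intro h
      obtain ⟨s, hs⟩ := hx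
      exact hd hs (h.ge (Finset.mem_union_left _ hs)))
  have hne : t ≠ t' := by
    rintro rfl
    exact hd ht ht'
  rw [show r.length * 2 = r.length * ({t, t'} : Finset (ZMod L)).card by rw [Finset.card_pair hne]]
  refine hr.two_mul_card_union_add_le hc hmax rfl h2 ?_ fun s hs => ?_
  · intro s hs
    rcases Finset.mem_insert.1 hs with rfl | hs
    · exact Finset.mem_union_left _ ht
    · exact Finset.mem_union_right _ (Finset.mem_singleton.1 hs ▸ ht')
  · rcases Finset.mem_insert.1 hs with rfl | hs
    · exact Or.inl ⟨ht, (Finset.mem_union.1 hn).resolve_left hnt⟩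
    · rw [Finset.mem_singleton.1 hs]
      exact Or.inr ⟨ht', (Finset.mem_union.1 hn').resolve_right hnt'⟩

end IsLongestOutside

end SimpleGraph

namespace SimpleGraph

variable {V : Type u} {G : SimpleGraph V} {L : ℕ}

/-! ### Lower bounds for the length of a longest cycle -/

/-- The case `q ≥ K` of the length bound, where the `q`-cycle alone is enough. -/
theorem four_mul_le_of_le {K L q t : ℕ} (h3 : 3 ≤ q) (hKq : K ≤ q) (hKt : K ≤ t)
    (h : 2 * t + ((q + 1) / 2) * min q K ≤ L) : 4 * K ≤ L := by
  rw [min_eq_right hKq] at h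
  have : 2 * K ≤ ((q + 1) / 2) * K := Nat.mul_le_mul_right K (by omega)
  omega

/-- The arithmetic of the case in which the ends of the path have different neighbourhoods on the
cycle. Here `l` is the length of the path; `α`, `β` count the neighbours of its ends on the cycle,
`a` the common ones, `u` those of either, and `t` all attachments of the component. -/
theorem four_mul_le_of_ne {K L l q α β a u t : ℕ} (hK : 3 ≤ K) (hl : 2 ≤ l) (hq : 2 ≤ q)
    (hql : q ≤ l + 1) (hα : K + 1 ≤ α + q) (hβ : K + 1 ≤ β + q) (hua : u + a = α + β) (hut : u ≤ t)
    (hKt : K ≤ t) (hz : 3 ≤ q → 2 * t + ((q + 1) / 2) * min q K ≤ L)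
    (h1 : q < K → 1 ≤ a → 2 * u + l * (a + 1) ≤ L) (h0 : q < K → a = 0 → 2 * u + l * 2 ≤ L) :
    4 * K ≤ L + 7 := by
  rcases le_or_gt K q with hKq | hKq
  · have := four_mul_le_of_le (hK.trans hKq) hKq hKt (hz (hK.trans hKq))
    omega
  have h1 := h1 hKq
  have h0 := h0 hKq
  rw [min_eq_left hKq.le] at hz
  have hcases : a = 0 ∨ a = 1 ∨ a = 2 ∨ 3 ≤ a := by omega
  rcases le_or_gt q 3 with hq3 | hq4
  · rcases Nat.eq_zero_or_pos a with ha | ha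
    · have := h0 ha
      omega
    · have := h1 ha
      have : 2 * (a + 1) ≤ l * (a + 1) := Nat.mul_le_mul_right _ hl
      omega
  have hz := hz (by omega)
  by_cases ha3 : 3 ≤ a
  · have := h1 (by omega)
    obtain ⟨l', rfl⟩ : ∃ l', l = l' + 2 := ⟨l - 2, by omega⟩
    have : l' * 4 ≤ l' * (a + 1) := Nat.mul_le_mul_left _ (by omega)
    rw [add_mul] at *
    omega
  rcases (by omega : q = 4 ∨ q = 5 ∨ q = 6 ∨ 7 ≤ q) with rfl | rfl | rfl | hq7
  · rcases (by omega : a = 0 ∨ a = 1 ∨ a = 2) with rfl | rfl | rfl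
    · omega
    · omega
    · have := h1 (by omega)
      omega
  · omega
  · omega
  · have : 4 * q ≤ ((q + 1) / 2) * q := Nat.mul_le_mul_right q (by omega)
    omega

/-- The arithmetic of the case in which the ends of the path have the same `α` neighbours on the
cycle, unless the path spans a triangle. -/
theorem four_mul_le_of_eq {K L l q α t : ℕ} (hK : 3 ≤ K) (hl : 2 ≤ l) (hq : 2 ≤ q)
    (hql : q ≤ l + 1) (hα : K + 1 ≤ α + q) (hKt : K ≤ t)
    (hz : 3 ≤ q → 2 * t + ((q + 1) / 2) * min q K ≤ L)
    (h1 : q < K → 2 * α + l * α ≤ L) (hne : ¬ (q = 3 ∧ l = 2)) : 4 * K ≤ L + 7 := by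
  rcases le_or_gt K q with hKq | hKq
  · have := four_mul_le_of_le (hK.trans hKq) hKq hKt (hz (hK.trans hKq))
    omega
  have h1 := h1 hKq
  rw [min_eq_left hKq.le] at hz
  rcases (by omega : q = 2 ∨ q = 3 ∨ 4 ≤ q) with rfl | rfl | hq4
  · have : 2 * α ≤ l * α := Nat.mul_le_mul_right _ hl
    omega
  · have : 3 * α ≤ l * α := Nat.mul_le_mul_right _ (by omega)
    omega
  · have hz := hz (by omega)
    by_contra! hlt
    -- The two bounds give `q ^ 2 ≤ 4 K - 16` and `K ≤ q + 3`, hence `(q - 2) ^ 2 ≤ 0`.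
    have h2 : q * q ≤ 2 * (((q + 1) / 2) * q) := by
      rw [← mul_assoc]
      exact Nat.mul_le_mul_right q (by omega)
    have h3 : (q + 1) * α ≤ L := by nlinarith
    have h4 : (q + 1) * (K + 1) ≤ (q + 1) * (α + q) := Nat.mul_le_mul_left _ hα
    have h5 : K ≤ q + 3 := by
      by_contra! h
      zify at *
      nlinarith
    nlinarith

namespace IsLongestOutside

variable {c : ZMod L → V} {x y : V} {r : G.Walk x y}

theorem four_mul_le_of_attachments_ne [Finite V] [NeZero L] {K : ℕ} (hG : G.WellConnected K)
    (hK : 3 ≤ K) (hc : G.IsCyclicSeq c) (hmax : G.CycleLengthLE L) (hL : 3 ≤ L)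
    (hr : G.IsLongestOutside c r) (hr2 : 2 ≤ r.length)
    (hne : G.attachments c {x} ≠ G.attachments c {y}) : 4 * K ≤ L + 7 := by
  obtain ⟨q, hq, hql, -, hα, hβ, hz⟩ := hr.exists_bounds hG (by omega) hc hmax hL (by omega)
  have hle := Finset.card_le_card (Finset.subset_union_left (s₁ := G.attachments c {x})
    (s₂ := G.attachments c {y}))
  refine four_mul_le_of_ne hK hr2 hq hql hα hβ (Finset.card_union_add_card_inter _ _)
    (Finset.card_le_card (Finset.union_subset hr.attachments_start_subset
      hr.attachments_end_subset))
    (hG.le_card_attachments hc hmax hL hr.start_notMem) hz (fun hqK ha => ?_) fun hqK ha => ?_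
  · exact hr.two_mul_card_union_add_inter_succ_le hc hmax (by omega) hne (Finset.card_pos.1 ha)
  · exact hr.two_mul_card_union_add_two_mul_le hc hmax (by omega) (Finset.card_pos.1 (by omega))
      (Finset.card_pos.1 (by omega))
      (Finset.disjoint_iff_inter_eq_empty.2 (Finset.card_eq_zero.1 ha))

/-- If a longest path outside the cycle has two edges and spans a triangle, each of the three
vertices is an end of such a path, and there is no other vertex in their component. -/
theorem four_mul_le_of_triangle [Finite V] [NeZero L] {K : ℕ} (hG : G.WellConnected K)
    (hK : 3 ≤ K) (hc : G.IsCyclicSeq c) (hmax : G.CycleLengthLE L) (hL : 3 ≤ L)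
    {z : V} {hxz : G.Adj x z} {hzy : G.Adj z y}
    (hr : G.IsLongestOutside c (.cons hxz (.cons hzy .nil))) (hxy : G.Adj x y) :
    4 * K ≤ L + 7 := by
  have hav := hr.avoids
  have hr' : G.IsLongestOutside c (.cons hxz.symm (.cons hxy .nil)) := by
    refine ⟨?_, fun v hv => hav v ?_, by simpa using hr.length_le⟩
    · simp [hxz.ne', hxy.ne, hzy.ne]
    · simp at hv ⊢; tauto
  by_cases h1 : G.attachments c {x} = G.attachments c {y}
  swap
  · exact hr.four_mul_le_of_attachments_ne hG hK hc hmax hL (by simp) h1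
  by_cases h2 : G.attachments c {z} = G.attachments c {y}
  swap
  · exact hr'.four_mul_le_of_attachments_ne hG hK hc hmax hL (by simp) h2
  have hsub : G.reachAvoiding c x ⊆ {x, z, y} := by
    refine reachAvoiding_subset (by simp) fun v hv v' ha hv' => ?_
    rcases hv with rfl | rfl | rfl
    · simpa using hr.mem_support_of_adj ha hv'
    · have := hr'.mem_support_of_adj ha hv'
      simp at this ⊢; tauto
    · have := hr.reverse.mem_support_of_adj ha hv'
      simp at this ⊢; tauto
  have hT : G.attachments c (G.reachAvoiding c x) ⊆ G.attachments c {x} := by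
    intro i hi
    obtain ⟨v, hv, ha⟩ := mem_attachments.1 hi
    rcases hsub hv with rfl | rfl | rfl
    · exact mem_attachments_singleton.2 ha
    · rw [h1, ← h2]; exact mem_attachments_singleton.2 ha
    · rw [h1]; exact mem_attachments_singleton.2 ha
  have hKT := (hG.le_card_attachments hc hmax hL hr.start_notMem).trans (Finset.card_le_card hT)
  have := hr.two_mul_card_union_add_inter_le hc hmax (by rw [← h1, Finset.union_self]; omega)
  rw [← h1, Finset.union_self, Finset.inter_self] at this
  simp at this
  omega

/-- If there is a path with two edges outside a longest cycle, then `4 K - 7` is a lower bound for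
the length of the cycle. -/
theorem four_mul_le [Finite V] [NeZero L] {K : ℕ} (hG : G.WellConnected K)
    (hK : 3 ≤ K) (hc : G.IsCyclicSeq c) (hmax : G.CycleLengthLE L) (hL : 3 ≤ L)
    (hr : G.IsLongestOutside c r) (hr2 : 2 ≤ r.length) : 4 * K ≤ L + 7 := by
  by_cases hne : G.attachments c {x} = G.attachments c {y}
  swap
  · exact hr.four_mul_le_of_attachments_ne hG hK hc hmax hL hr2 hne
  obtain ⟨q, hq, hql, hxy, hα, hβ, hz⟩ := hr.exists_bounds hG (by omega) hc hmax hL (by omega)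
  by_cases h32 : q = 3 ∧ r.length = 2
  · have hadj := hxy (by omega)
    obtain ⟨-, hr2⟩ := h32
    match r, hr, hr2 with
    | .cons _ (.cons _ .nil), hr, _ => exact hr.four_mul_le_of_triangle hG hK hc hmax hL hadj
  refine four_mul_le_of_eq hK hr2 hq hql hα (hG.le_card_attachments hc hmax hL hr.start_notMem) hz
    (fun hqK => ?_) h32
  have := hr.two_mul_card_union_add_inter_le hc hmax (by rw [← hne, Finset.union_self]; omega)
  rwa [← hne, Finset.union_self, Finset.inter_self] at this

/-- If a longest path outside a longest cycle is a single edge, then its two ends are a component,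
and `3 K - 2` is a lower bound for the length of the cycle. -/
theorem three_mul_le [Finite V] [NeZero L] {K : ℕ} (hG : G.WellConnected K)
    (hK : 3 ≤ K) (hc : G.IsCyclicSeq c) (hmax : G.CycleLengthLE L) (hL : 3 ≤ L)
    (hr : G.IsLongestOutside c r) (hr1 : r.length = 1) : 3 * K ≤ L + 2 := by
  obtain ⟨q, hq, hql, -, hα, hβ, -⟩ := hr.exists_bounds hG (by omega) hc hmax hL hr1.ge
  have hsupp : ∀ v ∈ r.support, v = x ∨ v = y := by
    match r, hr1 with
    | .cons _ .nil, _ => simp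
  have hsub : G.reachAvoiding c x ⊆ {x, y} := by
    refine reachAvoiding_subset (by simp) fun v hv v' ha hv' => hsupp v' ?_
    rcases hv with rfl | rfl
    · exact hr.mem_support_of_adj ha hv'
    · simpa using hr.reverse.mem_support_of_adj ha hv'
  have hT : G.attachments c (G.reachAvoiding c x) ⊆
      G.attachments c {x} ∪ G.attachments c {y} := by
    intro i hi
    obtain ⟨v, hv, ha⟩ := mem_attachments.1 hi
    rw [Finset.mem_union]
    rcases hsub hv with rfl | rfl
    · exact Or.inl (mem_attachments_singleton.2 ha)
    · exact Or.inr (mem_attachments_singleton.2 ha)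
  have hKT := (hG.le_card_attachments hc hmax hL hr.start_notMem).trans (Finset.card_le_card hT)
  have h1 := hr.two_mul_card_union_add_inter_le hc hmax (by omega)
  have h2 := Finset.card_union_add_card_inter (G.attachments c {x}) (G.attachments c {y})
  rw [hr1] at h1
  omega

end IsLongestOutside

/-! ### The intersection of two longest cycles -/

/-- If `r + 1` consecutive vertices of a cycle `d` lie outside the cycle `c`, then some path with
`r` edges does. -/
theorem IsCyclicSeq.exists_path_of_notMem {c d : ZMod L → V} (hd : G.IsCyclicSeq d)
    {r : ℕ} (hr : r < L) {j : ZMod L} (h : ∀ i ≤ r, d (j + (i : ZMod L)) ∉ Set.range c) :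
    ∃ (u v : V) (w : G.Walk u v), w.IsPath ∧ w.length = r ∧ ∀ s ∈ w.support, s ∉ Set.range c := by
  obtain ⟨w, hw, hl, hs⟩ := hd.exists_arc j r hr
  refine ⟨_, _, w, hw, hl, fun s hs' => ?_⟩
  obtain ⟨i, hi, rfl⟩ := hs s hs'
  exact h i hi

/-- If `c` and `d` share few vertices, then `d` has long segments outside `c`, hence `c` is long by
the length bounds, hence `c` and `d` together have too many vertices. -/
theorem WellConnected.le_ncard_inter [Fintype V] {K : ℕ} (hG : G.WellConnected K)
    (hK : 3 ≤ K) (hn : Fintype.card V + 14 ≤ 7 * K) (hL : 3 ≤ L) {c d : ZMod L → V}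
    (hc : G.IsCyclicSeq c) (hd : G.IsCyclicSeq d) (hmax : G.CycleLengthLE L) :
    K ≤ (Set.range c ∩ Set.range d).ncard := by
  classical
  have : NeZero L := ⟨by omega⟩
  have hrange : ∀ {f : ZMod L → V}, Function.Injective f → (Set.range f).ncard = L := by
    intro f hf
    rw [Set.ncard_range_of_injective hf, Nat.card_zmod]
  have hinter := Set.ncard_union_add_ncard_inter (Set.range c) (Set.range d)
  rw [hrange hc.inj, hrange hd.inj] at hinter
  have hunion := Set.ncard_le_card (Set.range c ∪ Set.range d)
  rw [Nat.card_eq_fintype_card] at hunion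
  by_cases hall : ∀ v, v ∈ Set.range c
  · have h1 : Set.range c = Set.univ := Set.eq_univ_of_forall hall
    have h2 := hG.le_degree (c 0)
    have h3 := Set.ncard_le_ncard (Set.subset_univ (G.neighborSet (c 0)))
    rw [h1, Set.univ_inter, hrange hd.inj, ← hrange hc.inj, h1]
    exact h2.trans h3
  push Not at hall
  obtain ⟨v, hv⟩ := hall
  obtain ⟨x, y, r, hr⟩ := exists_isLongestOutside (G := G) c hv
  set M : Finset (ZMod L) := {j | d j ∈ Set.range c} with hM
  have hMcard : M.card = (Set.range c ∩ Set.range d).ncard := by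
    rw [← Finset.card_image_of_injective M hd.inj, ← Set.ncard_coe_finset]
    congr 1
    ext s
    simp only [hM, Finset.coe_image, Finset.coe_filter, Finset.mem_univ, true_and, Set.mem_image,
      Set.mem_ofPred_eq, Set.mem_inter_iff]
    constructor
    · rintro ⟨j, hj, rfl⟩
      exact ⟨hj, j, rfl⟩
    · rintro ⟨hs, j, rfl⟩
      exact ⟨j, hs, rfl⟩
  have hcons : ∀ m, r.length < m → m < L → L ≤ (m + 1) * M.card := by
    intro m hm hmL
    refine ZMod.le_mul_card_of_consecutive M fun j => ?_
    by_contra! h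
    obtain ⟨u, v, w, hw, hl, hs⟩ := hd.exists_path_of_notMem (c := c) hmL (j := j) fun i hi hi' =>
      h i (by omega) (by simpa [hM] using hi')
    have := hr.length_le w hw hs
    omega
  have h2K := hG.two_mul_le (by omega) hc hmax hL hv
  rcases (by omega : r.length = 0 ∨ r.length = 1 ∨ 2 ≤ r.length) with h | h | h
  · have := hcons 1 (by omega) (by omega)
    omega
  · have := hcons 2 (by omega) (by omega)
    have := hr.three_mul_le hG hK hc hmax hL h
    omega
  · have := hr.four_mul_le hG hK hc hmax hL h
    omega

end SimpleGraph

namespace SimpleGraph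

variable {V : Type u} {G : SimpleGraph V}

/-! ### From internally disjoint paths to connectivity -/

theorem Walk.IsPath.length_eq_one_of_snd_eq {a b : V} {w : G.Walk a b} (hw : w.IsPath)
    (hab : a ≠ b) (h : w.snd = b) : w.length = 1 := by
  cases w with
  | nil => exact absurd rfl hab
  | cons e p =>
    rw [Walk.snd_cons] at h
    subst h
    rw [Walk.cons_isPath_iff, Walk.isPath_iff_nil] at hw
    simp [hw.1.eq_nil]

/-- Internally disjoint paths from `a` have different second vertices, and they meet a set that
separates their ends in different vertices. -/
theorem IsKConnected.wellConnected {k : ℕ} [Finite V] (h : G.IsKConnected k) :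
    G.WellConnected k := by
  classical
  refine ⟨fun X hX a b ha hb => ?_, fun a => ?_⟩
  · rcases eq_or_ne a b with rfl | hab
    · exact ⟨.nil, by simpa using ha⟩
    obtain ⟨S, rfl, hS⟩ := h.2 a b hab
    by_contra! hcon
    choose f hf hfX using fun P : G.Path a b => hcon P.1
    refine hX.not_ge (Finset.card_le_card_of_injOn f (fun P _ => hfX P) fun P hP Q hQ hPQ => ?_)
    by_contra hne
    rcases hS P hP Q hQ hne (f P) (hf P) (hPQ ▸ hf Q) with e | e
    · exact ha (e ▸ hfX P)
    · exact hb (e ▸ hfX P)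
  · obtain ⟨hnt, h⟩ := h
    obtain ⟨b, hb⟩ := exists_ne a
    obtain ⟨S, rfl, hS⟩ := h a b hb.symm
    have hadj : ∀ P : G.Path a b, G.Adj a P.1.snd := fun P =>
      P.1.adj_snd (Walk.not_nil_of_ne hb.symm)
    rw [← Set.ncard_coe_finset]
    refine Set.ncard_le_ncard_of_injOn (fun P : G.Path a b => P.1.snd) (fun P _ => hadj P)
      (fun P hP Q hQ hPQ => ?_) (Set.toFinite _)
    by_contra hne
    have hPQ : P.1.snd = Q.1.snd := hPQ
    rcases hS P hP Q hQ hne P.1.snd (P.1.getVert_mem_support 1)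
      (by rw [hPQ]; exact Q.1.getVert_mem_support 1) with e | e
    · exact (hadj P).ne e.symm
    · -- Both paths consist of the single edge `ab`.
      have h1 := P.2.length_eq_one_of_snd_eq hb.symm e
      have h2 := Q.2.length_eq_one_of_snd_eq hb.symm (hPQ ▸ e)
      refine hne (Subtype.ext ?_)
      match P.1, Q.1, h1, h2 with
      | .cons _ .nil, .cons _ .nil, _, _ => rfl

/-! ### Longest cycles and longest paths given by walks -/

theorem Walk.IsPath.cons_isCycle {x y : V} {w : G.Walk x y} (hw : w.IsPath) (h : G.Adj y x)
    (hl : 2 ≤ w.length) : (Walk.cons h w).IsCycle := by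
  rw [Walk.cons_isCycle_iff]
  refine ⟨hw, fun he => ?_⟩
  cases w with
  | nil => simp at hl
  | cons e p =>
    rw [Walk.cons_isPath_iff] at hw
    rw [Walk.edges_cons, List.mem_cons] at he
    rcases he with he | he
    · rw [Sym2.eq_swap, Sym2.congr_right] at he
      subst he
      rw [Walk.isPath_iff_nil] at hw
      simp [hw.1.eq_nil] at hl
    · exact hw.2 (p.snd_mem_support_of_mem_edges he)

theorem Walk.IsCycle.exists_isCyclicSeq {L : ℕ} {a : V} {C : G.Walk a a} (hC : C.IsCycle)
    (hL : C.length = L) :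
    ∃ c : ZMod L → V, G.IsCyclicSeq c ∧ ∀ v, v ∈ Set.range c ↔ v ∈ C.support := by
  cases C with
  | nil => exact absurd rfl hC.ne_nil
  | cons h p =>
    obtain ⟨c, hc, hs⟩ := ((Walk.cons_isCycle_iff _ _).1 hC).1.exists_isCyclicSeq h hL
    refine ⟨c, hc, fun v => ?_⟩
    rw [hs, Walk.support_cons, List.mem_cons]
    refine ⟨Or.inr, ?_⟩
    rintro (rfl | hv)
    · exact p.end_mem_support
    · exact hv

theorem Walk.IsLongestCycle.cycleLengthLE {a : V} {C : G.Walk a a} (hC : C.IsLongestCycle) :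
    G.CycleLengthLE C.length := fun x y w hw h hl => by
  simpa using hC.2 _ _ (hw.cons_isCycle h hl)

theorem WellConnected.le_ncard_inter_of_isLongestCycle [Fintype V] {K : ℕ}
    (hG : G.WellConnected K) (hK : 3 ≤ K) (hn : Fintype.card V + 14 ≤ 7 * K) {a b : V}
    {C : G.Walk a a} {D : G.Walk b b} (hC : C.IsLongestCycle) (hD : D.IsLongestCycle) :
    K ≤ {x : V | x ∈ C.support ∧ x ∈ D.support}.ncard := by
  obtain ⟨c, hc, hcs⟩ := hC.1.exists_isCyclicSeq rfl
  obtain ⟨d, hd, hds⟩ := hD.1.exists_isCyclicSeq (le_antisymm (hC.2 _ _ hD.1) (hD.2 _ _ hC.1))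
  have := hG.le_ncard_inter hK hn hC.1.three_le_length hc hd hC.cycleLengthLE
  refine this.trans_eq (congrArg Set.ncard (Set.ext fun v => ?_))
  exact and_congr (hcs v) (hds v)

/-! ### The cone over a graph -/

/-- The graph obtained from `G` by adding a vertex `none` that is adjacent to all others. -/
def cone (G : SimpleGraph V) : SimpleGraph (Option V) where
  Adj s t := s ≠ t ∧ ∀ a b, s = some a → t = some b → G.Adj a b
  symm := ⟨fun _ _ h => ⟨h.1.symm, fun a b ha hb => (h.2 b a hb ha).symm⟩⟩
  loopless := ⟨fun _ h => h.1 rfl⟩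

theorem cone_adj_some {a b : V} : G.cone.Adj (some a) (some b) ↔ G.Adj a b :=
  ⟨fun h => h.2 a b rfl rfl, fun h => ⟨by simpa using h.ne, by rintro _ _ ⟨⟩ ⟨⟩; exact h⟩⟩

theorem cone_adj_none (a : V) : G.cone.Adj none (some a) :=
  ⟨by simp, by simp⟩

theorem Walk.exists_walk_cone {a b : V} (w : G.Walk a b) :
    ∃ p : G.cone.Walk (some a) (some b), p.support = w.support.map some := by
  induction w with
  | nil => exact ⟨.nil, by simp⟩
  | cons h w ih =>
    obtain ⟨p, hp⟩ := ih
    exact ⟨.cons (cone_adj_some.2 h) p, by simp [hp]⟩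

theorem Walk.exists_walk_of_cone {s t : Option V} (w : G.cone.Walk s t) (hw : none ∉ w.support)
    {a b : V} (ha : s = some a) (hb : t = some b) :
    ∃ p : G.Walk a b, p.support.map some = w.support := by
  induction w generalizing a with
  | nil =>
    subst ha
    cases hb
    exact ⟨.nil, by simp⟩
  | @cons s r t h w ih =>
    subst ha
    match r, h, w, ih, hw with
    | none, _, w, _, hw => exact absurd (by simp) hw
    | some r, h, w, ih, hw =>
      obtain ⟨p, hp⟩ := ih (fun h => hw (by simp [h])) rfl hb
      exact ⟨.cons (cone_adj_some.1 h) p, by simp [hp]⟩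

theorem exists_walk_cone_none (s : Option V) :
    ∃ w : G.cone.Walk s none, ∀ v ∈ w.support, v = s ∨ v = none := by
  cases s with
  | none => exact ⟨.nil, by simp⟩
  | some a => exact ⟨.cons (cone_adj_none a).symm .nil, by simp⟩

theorem WellConnected.cone [Finite V] [Nonempty V] {k : ℕ} (hG : G.WellConnected k) :
    G.cone.WellConnected (k + 1) := by
  classical
  refine ⟨fun X hX s t hs ht => ?_, fun s => ?_⟩
  · by_cases hn : none ∈ X
    · match s, t, hs, ht with
      | none, _, hs, _ => exact absurd hn hs
      | _, none, _, ht => exact absurd hn ht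
      | some a, some b, ha, hb =>
        have hcard : X.eraseNone.card < k := by
          have h1 := Finset.card_lt_card (Finset.erase_ssubset hn)
          rw [← Finset.map_some_eraseNone, Finset.card_map] at h1
          omega
        obtain ⟨w, hw⟩ := hG.exists_walk X.eraseNone hcard a b (by simpa using ha)
          (by simpa using hb)
        obtain ⟨p, hp⟩ := w.exists_walk_cone
        refine ⟨p, fun v hv => ?_⟩
        rw [hp, List.mem_map] at hv
        obtain ⟨v, hv, rfl⟩ := hv
        simpa using hw v hv
    · obtain ⟨w, hw⟩ := G.exists_walk_cone_none s
      obtain ⟨w', hw'⟩ := G.exists_walk_cone_none t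
      refine ⟨w.append w'.reverse, fun v hv => ?_⟩
      rw [Walk.mem_support_append_iff, Walk.support_reverse, List.mem_reverse] at hv
      rcases hv with hv | hv
      · rcases hw v hv with rfl | rfl <;> assumption
      · rcases hw' v hv with rfl | rfl <;> assumption
  · have hsome : ∀ S : Set V, (some '' S).ncard = S.ncard := fun S =>
      Set.ncard_image_of_injective S (Option.some_injective V)
    cases s with
    | none =>
      obtain ⟨a⟩ := ‹Nonempty V›
      have h1 : insert (some a) (some '' G.neighborSet a) ⊆ G.cone.neighborSet none := by
        rw [← Set.image_insert_eq]
        rintro _ ⟨b, -, rfl⟩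
        exact cone_adj_none b
      refine le_trans ?_ (Set.ncard_le_ncard h1)
      rw [Set.ncard_insert_of_notMem (by simp), hsome]
      exact Nat.succ_le_succ (hG.le_degree a)
    | some a =>
      have h1 : insert none (some '' G.neighborSet a) ⊆ G.cone.neighborSet (some a) := by
        rintro _ (rfl | ⟨b, hb, rfl⟩)
        · exact (cone_adj_none a).symm
        · exact cone_adj_some.2 hb
      refine le_trans ?_ (Set.ncard_le_ncard h1)
      rw [Set.ncard_insert_of_notMem (by simp), hsome]
      exact Nat.succ_le_succ (hG.le_degree a)

/-- A cycle of the cone becomes a path of `G` when the apex is deleted, or any edge if the cycle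
avoids the apex. -/
theorem cycleLengthLE_cone {l : ℕ}
    (h : ∀ (a b : V) (p : G.Walk a b), p.IsPath → p.length ≤ l) : G.cone.CycleLengthLE (l + 2) := by
  have main : ∀ {s t : Option V} (w : G.cone.Walk s t), w.IsPath → none ∉ w.support →
      w.length ≤ l := by
    intro s t w hw hn
    obtain ⟨a, rfl⟩ := Option.ne_none_iff_exists'.1 fun e => hn (e ▸ w.start_mem_support)
    obtain ⟨b, rfl⟩ := Option.ne_none_iff_exists'.1 fun e => hn (e ▸ w.end_mem_support)
    obtain ⟨p, hp⟩ := w.exists_walk_of_cone hn rfl rfl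
    have hlen := congrArg List.length hp
    rw [List.length_map, Walk.length_support, Walk.length_support] at hlen
    have := h a b p (p.isPath_def.2 (List.Nodup.of_map some (hp ▸ hw.support_nodup)))
    omega
  intro s t w hw hts h2
  by_cases hn : none ∈ w.support
  · obtain ⟨c, hc, hcs⟩ := hw.exists_isCyclicSeq hts rfl
    obtain ⟨i, hi⟩ := (hcs none).2 hn
    obtain ⟨p, hp, hpl, hps⟩ := hc.exists_arc (i + 1) (w.length - 1) (by omega)
    have := main p hp fun hnp => by
      obtain ⟨j, hj, hjn⟩ := hps _ hnp
      have e : i + ((j + 1 : ℕ) : ZMod (w.length + 1)) = i + ((0 : ℕ) : ZMod (w.length + 1)) := by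
        refine (hc.inj ?_).trans (by simp : i = _)
        rw [hi, hjn]
        congr 1
        push_cast
        ring
      have := ZMod.add_natCast_injOn i (by omega) (by omega) e
      omega
    omega
  · have := main w hw hn
    omega

/-- A path of `G` and the apex form a cycle of the cone. -/
theorem Walk.IsPath.exists_isCyclicSeq_cone {L : ℕ} {a b : V} {P : G.Walk a b} (hP : P.IsPath)
    (hL : P.length + 2 = L) : ∃ c : ZMod L → Option V, G.cone.IsCyclicSeq c ∧
      Set.range c = insert none (some '' {v | v ∈ P.support}) := by
  obtain ⟨p, hp⟩ := P.exists_walk_cone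
  have hlen := congrArg List.length hp
  rw [List.length_map, Walk.length_support, Walk.length_support] at hlen
  have hpath : (Walk.cons (cone_adj_none a) p).IsPath := by
    rw [Walk.cons_isPath_iff, Walk.isPath_def, hp]
    exact ⟨hP.support_nodup.map (Option.some_injective V), by simp⟩
  obtain ⟨c, hc, hcs⟩ := hpath.exists_isCyclicSeq (L := L) (cone_adj_none b).symm
    (by rw [Walk.length_cons]; omega)
  refine ⟨c, hc, Set.ext fun v => ?_⟩
  rw [hcs, Walk.support_cons, List.mem_cons, hp, List.mem_map]
  rfl

theorem WellConnected.le_ncard_inter_of_isLongestPath [Fintype V] {k : ℕ}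
    (hG : G.WellConnected k) (hk : 2 ≤ k) (hn : Fintype.card V + 8 ≤ 7 * k) {a b a' b' : V}
    {P : G.Walk a b} {Q : G.Walk a' b'} (hP : P.IsLongestPath) (hQ : Q.IsLongestPath) :
    k ≤ {x : V | x ∈ P.support ∧ x ∈ Q.support}.ncard := by
  classical
  have : Nonempty V := ⟨a⟩
  have hlen : 1 ≤ P.length := by
    obtain ⟨v, hv⟩ : (G.neighborSet a).Nonempty :=
      Set.nonempty_of_ncard_ne_zero (by have := hG.le_degree a; omega)
    have hv : G.Adj a v := hv
    simpa using hP.2 _ _ (.cons hv .nil) (by simp [hv.ne])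
  obtain ⟨c, hc, hcs⟩ := hP.1.exists_isCyclicSeq_cone rfl
  obtain ⟨d, hd, hds⟩ := hQ.1.exists_isCyclicSeq_cone
    (congrArg (· + 2) (le_antisymm (hP.2 _ _ _ hQ.1) (hQ.2 _ _ _ hP.1)))
  have := hG.cone.le_ncard_inter (by omega) (by rw [Fintype.card_option]; omega) (by omega) hc hd
    (cycleLengthLE_cone fun _ _ p hp => hP.2 _ _ p hp)
  rw [hcs, hds, ← Set.insert_inter_distrib, ← Set.image_inter (Option.some_injective V),
    Set.ncard_insert_of_notMem (by simp),
    Set.ncard_image_of_injective _ (Option.some_injective V)] at this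
  exact Nat.le_of_succ_le_succ this

end SimpleGraph

theorem mainTheorem3 (n k : ℕ) :
    (((n : ℝ) + 16) / 7 ≤ (k : ℝ) → LongestCyclesConjecture.{u} n k k) ∧
    (((n : ℝ) + 9) / 7 ≤ (k : ℝ) → LongestPathsConjecture.{u} n k k) := by
  refine ⟨fun h V _ G hV hG a b C D hC hD => ?_, fun h V _ G hV hG a b c d P Q hP hQ => ?_⟩
  · have h' : n + 16 ≤ 7 * k := by
      rw [div_le_iff₀ (by norm_num)] at h
      have : (n : ℝ) + 16 ≤ 7 * k := by linarith
      exact_mod_cast this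
    exact hG.wellConnected.le_ncard_inter_of_isLongestCycle (by omega) (by omega) hC hD
  · have h' : n + 9 ≤ 7 * k := by
      rw [div_le_iff₀ (by norm_num)] at h
      have : (n : ℝ) + 9 ≤ 7 * k := by linarith
      exact_mod_cast this
    exact hG.wellConnected.le_ncard_inter_of_isLongestPath (by omega) (by omega) hP hQ
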